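/- Let $X$ be a standard Borel space. A subrelation on a Borel set $D\subseteq X$ is a Borel equivalence relation on $D$ with countable classes. Let $S$ be an equivalence relation on a set $D$ and let $(S_j)_{j\in J}$ be a countable family of such subrelations, where $S_j$ is defined on the Borel set $D_j\subseteq D$ and is contained in $S$. We say that $S$ is the free product of the $S_j$, written $S=\star_{j}S_j$, if $S$ is the smallest equivalence relation on $D$ containing all the $S_j$ and if, whenever $n\ge 2$, $x_1,\dots,x_n\in D$ and $j_1,\dots,j_{n-1}\in J$ satisfy $x_n=x_1$, $(x_k,x_{k+1})\in S_{j_k}$ for $1\le k\le n-1$ and $j_k\ne j_{k+1}$ for $1\le k\le n-2$, there is $k\le n-1$ with $x_k=x_{k+1}$. A subrelation on $D$ is treeable if there is an acyclic Borel graph on $D$ whose connected components are its classes. For an equivalence relation $S$ on a subset of $X$ and $B\subseteq X$, write $S\cdot B$ for the set of points that are $S$-equivalent to a point of $B$, and $S|_B$ for the restriction of $S$ to $B$. For a Borel equivalence relation $\mathcal R$ on $X$, write $[[\mathcal R]]$ for the set of Borel isomorphisms $\varphi:B\to C$ between Borel subsets of $X$ with $(x,\varphi(x))\in\mathcal R$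 for all $x\in B$. For an equivalence relation $S$ on $C$, $\varphi^{-1}S\varphi$ is the relation on $B$ in which $x,y$ are equivalent if and only if $(\varphi(x),\varphi(y))\in S$. **Theorem.** Let $\mathcal R$ be a Borel equivalence relation with countable classes on $X$ that is the free product of a countable family of subrelations $\mathcal R_i$ ($i\in I$) defined on Borel sets $A_i\subseteq X$ with $\bigcup_{i\in I}A_i=X$. Let $A\subseteq X$ be any Borel set. Then there are countable sets $K(i)$ ($i\in I$), elements $\varphi_{k}:A_{k}\to\varphi_k(A_k)$ of $[[\mathcal R]]$ ($k\in K(i)$, $i\in I$) with $A_k$ a nonempty Borel subset of $A$ and $\varphi_k(A_k)\subseteq A_i$ for $k\in K(i)$, and a treeable subrelation $\mathcal T$ of $\mathcal R|_A$ defined on a Borel subset of $A$, such that $$\mathcal R|_A=\star_{i\in I}\bigl(\star_{k\in K(i)}\mathcal S_{k}\bigr)\star\mathcal T,\qquad \mathcal S_{k}=\varphi_{k}^{-1}\,\mathcal R_i|_{\varphi_{k}(A_{k})}\,\varphi_{k}\quad(k\in K(i)),$$ that is, $\mathcal R|_A$ is the free product of the family consisting of all the $\mathcal S_k$ and of $\mathcal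 T$. Moreover, for every $i\in I$, the $\mathcal R_i$-saturations $\mathcal R_i\cdot\varphi_k(A_k)$, $k\in K(i)$, are Borel and pairwise disjoint, and their union is $A_i\cap(\mathcal R\cdot A)$; in particular they form a countable Borel partition of $A_i$ when $A$ meets every $\mathcal R$-class. Finally, for every $i\in I$ with $A_i\cap A\neq\emptyset$ there is $k\in K(i)$ with $A_k=A_i\cap A$ and $\mathcal S_k=\mathcal R_i|_{A_i\cap A}$. -/

import Mathlib

namespace BER

/-- `r` is a Borel equivalence relation with countable classes on the Borel subset `D` of `X`.
It is encoded as a relation on `X` that holds only between points of `D`. -/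
structure IsCountableBorelEquivOn {X : Type*} [MeasurableSpace X]
    (D : Set X) (r : X → X → Prop) : Prop where
  measurableSet_domain : MeasurableSet D
  measurableSet_graph : MeasurableSet {p : X × X | r p.1 p.2}
  mem_domain : ∀ ⦃x y : X⦄, r x y → x ∈ D ∧ y ∈ D
  refl : ∀ ⦃x : X⦄, x ∈ D → r x x
  symm : ∀ ⦃x y : X⦄, r x y → r y x
  trans : ∀ ⦃x y z : X⦄, r x y → r y z → r x z
  countable_class : ∀ x : X, {y : X | r x y}.Countable

/-- The restriction of the relation `r` to the subset `B`. -/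
def restr {X : Type*} (r : X → X → Prop) (B : Set X) : X → X → Prop :=
  fun x y => x ∈ B ∧ y ∈ B ∧ r x y

/-- The `r`-saturation of `B`: the points that are `r`-equivalent to a point of `B`. -/
def saturation {X : Type*} (r : X → X → Prop) (B : Set X) : Set X :=
  {y : X | ∃ x ∈ B, r x y}

/-- Membership in the full pseudogroup `[[R]]`: `φ` is a Borel isomorphism from the Borel set
`φ.source` onto the Borel set `φ.target`, and its graph is contained in `R`. -/
structure MemFullPseudogroup {X : Type*} [MeasurableSpace X]
    (R : X → X → Prop) (φ : PartialEquiv X X) : Prop where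
  measurableSet_source : MeasurableSet φ.source
  measurableSet_target : MeasurableSet φ.target
  measurable_toFun : Measurable (φ.source.domRestrict φ)
  measurable_invFun : Measurable (φ.target.domRestrict φ.symm)
  graph_subset : ∀ x ∈ φ.source, R x (φ x)

/-- The conjugate `φ⁻¹ s φ`, a relation on the source of `φ`:
`x` and `y` are related when `φ x` and `φ y` are `s`-related. -/
def conj {X : Type*} (φ : PartialEquiv X X) (s : X → X → Prop) : X → X → Prop :=
  fun x y => x ∈ φ.source ∧ y ∈ φ.source ∧ s (φ x) (φ y)

/-- The relation `R` on `D` is the free product of the subrelations `r j`, where `r j` is a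
countable Borel equivalence relation on the Borel set `E j`. -/
structure IsFreeProduct {X ι : Type*} [MeasurableSpace X]
    (D : Set X) (R : X → X → Prop) (E : ι → Set X) (r : ι → X → X → Prop) : Prop where
  factor : ∀ j, IsCountableBorelEquivOn (E j) (r j)
  subrelation : ∀ j x y, r j x y → R x y
  /-- `R` is the smallest equivalence relation on `D` that contains all the `r j`. -/
  generates : ∀ x y, R x y ↔
    x ∈ D ∧ y ∈ D ∧ Relation.EqvGen (fun a b => ∃ j, r j a b) x y
  /-- In a closed chain `x 0, …, x n = x 0` whose successive steps lie in factors with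
  successively distinct indices, some step is trivial. -/
  reduced : ∀ (n : ℕ) (x : ℕ → X) (j : ℕ → ι), 0 < n →
    (∀ k < n, r (j k) (x k) (x (k + 1))) →
    (∀ k, k + 1 < n → j k ≠ j (k + 1)) →
    x n = x 0 → ∃ k < n, x k = x (k + 1)

/-- The relation `r` is a treeable countable Borel equivalence relation on the Borel set `D`:
some acyclic Borel graph has the `r`-classes as its connected components on `D`
and has no edge outside `D`. -/
structure IsTreeable {X : Type*} [MeasurableSpace X]
    (D : Set X) (r : X → X → Prop) : Prop where
  isCountableBorelEquivOn : IsCountableBorelEquivOn D r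
  exists_treeing : ∃ G : SimpleGraph X,
    MeasurableSet {p : X × X | G.Adj p.1 p.2} ∧ G.IsAcyclic ∧
    (∀ x y, G.Adj x y → x ∈ D ∧ y ∈ D) ∧
    ∀ x y, r x y ↔ x ∈ D ∧ y ∈ D ∧ G.Reachable x y

end BER

/-! The proof is a Kurosh-type argument in which freeness is tested by cocycles. If `R` is the free
product of the `R' i`, then for any group and any potentials on the factors, the increments `g i x *
(g i y)⁻¹` extend to a cocycle on `R` (`IsFreeProduct.exists_cocycle`): multiply increments along a
chain, and note that reduced loops have length zero. Conversely, if all such increments extend,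
closed chains cannot be reduced (`exists_trivial_step_of_exists_cocycle`). The test uses a free
product of free groups, where a nonempty reduced chain spells a nontrivial reduced word. To show
that `R` restricted to `A` is a free product, it therefore suffices to extend potentials.

The geometric input is a retraction of the saturation of `A` onto `A`. Each point outside `A` has a
parent in a common factor class and strictly closer to `A`; following parents defines `proj`. Each
`R' i`-class in the saturation is assigned one set `piece i k`, on which `proj` is injective, and
`retract i` moves the class into it. The new factors are the images under `proj` of `R' i` on the
pieces. The edges joining `proj x` to `proj (retract i x)` make up for the points that are not in a
piece, and they generate the treeable part.

Parent steps preserve both `proj` and the relevant retraction. So data on the new factors and on the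
edges pull back to potentials on the `R' i` whose cocycle is trivial between `x` and `proj x`, and
it restricts to the prescribed data on `A` (`RetractionSystem.exists_cocycle`). With an integer
weight on one edge this shows that the graph is acyclic; with general potentials it shows freeness.

All choices are Borel because `R` is a countable union of graphs of Borel functions
(`IsCountableBorelEquivOn.exists_enum`), a form of the Lusin-Novikov theorem. -/

open MeasureTheory Set Filter Topology

namespace BER

/-! ### Lusin-Novikov uniformization: enumerating countable classes by Borel functions -/

section LusinNovikov

/-- The Cantor space. -/
abbrev Cantor : Type := ℕ → Bool

instance : PolishSpace Bool := by
  let := TopologicalSpace.metrizableSpaceMetric Bool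
  infer_instance

/-- `M` is a countable union of Borel graphs of partial functions. -/
def IsGraphUnion {α β : Type*} [MeasurableSpace α] [MeasurableSpace β] (M : Set (α × β)) : Prop :=
  ∃ Q : Set (Set (α × β)), Q.Countable ∧ (∀ q ∈ Q, MeasurableSet q ∧ InjOn Prod.fst q) ∧ M = ⋃₀ Q

theorem IsGraphUnion.measurableSet {α β : Type*} [MeasurableSpace α] [MeasurableSpace β]
    {M : Set (α × β)} (h : IsGraphUnion M) : MeasurableSet M := by
  obtain ⟨Q, hQ, hq, rfl⟩ := h
  exact MeasurableSet.sUnion hQ fun q h => (hq q h).1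

theorem IsGraphUnion.empty {α β : Type*} [MeasurableSpace α] [MeasurableSpace β] :
    IsGraphUnion (∅ : Set (α × β)) :=
  ⟨∅, countable_empty, by simp, by simp⟩

theorem IsGraphUnion.of_injOn {α β : Type*} [MeasurableSpace α] [MeasurableSpace β]
    {M : Set (α × β)} (hM : MeasurableSet M) (h : InjOn Prod.fst M) : IsGraphUnion M :=
  ⟨{M}, countable_singleton _, by simp [hM, h], by simp⟩

theorem IsGraphUnion.iUnion {α β : Type*} [MeasurableSpace α] [MeasurableSpace β]
    {M : ℕ → Set (α × β)} (h : ∀ n, IsGraphUnion (M n)) : IsGraphUnion (⋃ n, M n) := by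
  choose Q hQ hq hM using h
  refine ⟨⋃ n, Q n, countable_iUnion hQ, ?_, ?_⟩
  · intro q hqm
    obtain ⟨n, hn⟩ := mem_iUnion.1 hqm
    exact hq n q hn
  · rw [sUnion_iUnion]
    exact iUnion_congr hM

theorem IsGraphUnion.union {α β : Type*} [MeasurableSpace α] [MeasurableSpace β]
    {M N : Set (α × β)} (h : IsGraphUnion M) (h' : IsGraphUnion N) : IsGraphUnion (M ∪ N) := by
  obtain ⟨Q, hQ, hq, rfl⟩ := h
  obtain ⟨Q', hQ', hq', rfl⟩ := h'
  refine ⟨Q ∪ Q', hQ.union hQ', ?_, (sUnion_union _ _).symm⟩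
  rintro q (hqm | hqm)
  exacts [hq q hqm, hq' q hqm]

theorem _root_.MeasureTheory.AnalyticSet.inter {α : Type*} [TopologicalSpace α] [T2Space α]
    {s t : Set α} (hs : AnalyticSet s) (ht : AnalyticSet t) : AnalyticSet (s ∩ t) := by
  rw [inter_eq_iInter]
  refine AnalyticSet.iInter fun b => ?_
  cases b
  exacts [ht, hs]

/-- An analytic graph of a partial function into the Cantor space is contained in a Borel one. -/
theorem exists_measurableSet_injOn_fst {E : Set (Cantor × Cantor)} (hE : AnalyticSet E)
    (hinj : InjOn Prod.fst E) : ∃ Q, E ⊆ Q ∧ MeasurableSet Q ∧ InjOn Prod.fst Q := by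
  have hbit : ∀ (n : ℕ) (b : Bool), MeasurableSet {p : Cantor × Cantor | p.2 n = b} := fun n b =>
    measurableSet_eq_fun ((measurable_pi_apply n).comp measurable_snd) measurable_const
  -- Over each first coordinate `E` has at most one point, so the two projections are disjoint
  -- analytic sets, and Lusin separation applies.
  have hsep : ∀ n : ℕ, MeasurablySeparable (Prod.fst '' (E ∩ {p | p.2 n = true}))
      (Prod.fst '' (E ∩ {p | p.2 n = false})) := by
    intro n
    refine AnalyticSet.measurablySeparable
      ((hE.inter (hbit n true).analyticSet).image_of_continuous continuous_fst)
      ((hE.inter (hbit n false).analyticSet).image_of_continuous continuous_fst) ?_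
    rw [Set.disjoint_left]
    rintro _ ⟨p, ⟨hp, hpt⟩, rfl⟩ ⟨q, ⟨hq, hqt⟩, hpq⟩
    have : q = p := hinj hq hp hpq
    subst this
    simp only [mem_ofPred_eq] at hpt hqt
    simp [hpt] at hqt
  choose u hu hd hm using hsep
  -- The `n`-th bit of the second component is read off from membership of the first in `u n`, which
  -- makes this set a graph.
  refine ⟨⋂ n, {p | p.1 ∈ u n ↔ p.2 n = true}, ?_, ?_, ?_⟩
  · intro p hp
    refine mem_iInter.2 fun n => ⟨fun h => ?_, fun h => hu n ⟨p, ⟨hp, h⟩, rfl⟩⟩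
    by_contra hb
    exact Set.disjoint_left.1 (hd n) ⟨p, ⟨hp, by simpa using hb⟩, rfl⟩ h
  · refine MeasurableSet.iInter fun n => ?_
    have h1 : MeasurableSet {p : Cantor × Cantor | p.1 ∈ u n} := measurable_fst (hm n)
    exact h1.iff (hbit n true)
  · rintro ⟨x, y⟩ hp ⟨x', y'⟩ hq h
    obtain rfl : x = x' := h
    refine Prod.ext rfl (funext fun n => Bool.eq_iff_iff.2 ?_)
    exact (mem_iInter.1 hp n).symm.trans (mem_iInter.1 hq n)

variable (f : (ℕ → ℕ) → Cantor × Cantor)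

/-- The members of the family `F` have, off every countable union of Borel graphs, images under `f`
that meet a common vertical section. -/
def IsLarge (F : Set (Set (ℕ → ℕ))) : Prop :=
  ∀ M : Set (Cantor × Cantor), IsGraphUnion M →
    ∃ x : Cantor, ∀ U ∈ F, ∃ z ∈ U, (f z).1 = x ∧ f z ∉ M

variable {f}

theorem IsLarge.mono {F F' : Set (Set (ℕ → ℕ))} (h : IsLarge f F) (hF : F' ⊆ F) :
    IsLarge f F' := fun M hM => (h M hM).imp fun _ hx U hU => hx U (hF hU)

/-- If every piece failed, the union of the countably many exceptional sets would still be a graph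
union, and the point of `U` found off it would lie in some piece. -/
theorem IsLarge.exists_piece {F : Set (Set (ℕ → ℕ))} {U : Set (ℕ → ℕ)} (V : ℕ → Set (ℕ → ℕ))
    (hV : U ⊆ ⋃ m, V m) (h : IsLarge f (insert U F)) :
    ∃ m, IsLarge f (insert (U ∩ V m) F) := by
  by_contra! hcon
  simp only [IsLarge, not_forall] at hcon
  choose M hM hx using hcon
  obtain ⟨x, hx'⟩ := h _ (IsGraphUnion.iUnion hM)
  obtain ⟨z, hz, hzx, hzM⟩ := hx' U (mem_insert _ _)
  obtain ⟨m, hm⟩ := mem_iUnion.1 (hV hz)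
  refine hx m ⟨x, ?_⟩
  rintro W (rfl | hW)
  · exact ⟨z, ⟨hz, hm⟩, hzx, fun h => hzM (mem_iUnion.2 ⟨m, h⟩)⟩
  · obtain ⟨w, hw, hwx, hwM⟩ := hx' W (mem_insert_of_mem _ hW)
    exact ⟨w, hw, hwx, fun h => hwM (mem_iUnion.2 ⟨m, h⟩)⟩

/-- If no bit splits `U`, collect the exceptional sets into `N`. Over those sections that the whole
family meets off `N`, the image of `U` off `N` has at most one point. It is thus an analytic graph,
covered by a Borel graph `Q`, and `N ∪ Q` contradicts largeness. -/
theorem IsLarge.exists_split (hf : Continuous f) {F : Set (Set (ℕ → ℕ))} {U : Set (ℕ → ℕ)}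
    (hF : F.Countable) (hFm : ∀ W ∈ F, MeasurableSet W) (hU : MeasurableSet U)
    (h : IsLarge f (insert U F)) :
    ∃ k, IsLarge f (insert (U ∩ {z | (f z).2 k = true})
      (insert (U ∩ {z | (f z).2 k = false}) F)) := by
  by_contra! hcon
  simp only [IsLarge, not_forall] at hcon
  choose M hM hx using hcon
  set N := ⋃ n, M n with hN
  have hNu : IsGraphUnion N := IsGraphUnion.iUnion hM
  have han : ∀ W : Set (ℕ → ℕ), MeasurableSet W → AnalyticSet (f '' W ∩ Nᶜ) := fun W hW =>
    (hW.analyticSet_image hf.measurable).inter hNu.measurableSet.compl.analyticSet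
  have : Countable ↥(insert U F) := (hF.insert U).to_subtype
  have hEan : AnalyticSet ((f '' U ∩ Nᶜ) ∩
      ⋂ W : ↥(insert U F), Prod.fst ⁻¹' (Prod.fst '' (f '' (W : Set (ℕ → ℕ)) ∩ Nᶜ))) := by
    refine (han U hU).inter ?_
    have : Nonempty ↥(insert U F) := ⟨⟨U, mem_insert _ _⟩⟩
    refine AnalyticSet.iInter fun W => ?_
    refine AnalyticSet.preimage ((han W ?_).image_of_continuous continuous_fst) continuous_fst
    obtain ⟨W, rfl | hW⟩ := W
    exacts [hU, hFm _ hW]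
  obtain ⟨Q, hEQ, hQm, hQi⟩ := exists_measurableSet_injOn_fst hEan (by
    rintro p ⟨⟨⟨z, hz, rfl⟩, hzN⟩, hp⟩ q ⟨⟨⟨z', hz', rfl⟩, hzN'⟩, hq⟩ hpq
    refine Prod.ext hpq (funext fun k => ?_)
    by_contra hk
    refine hx k ⟨(f z).1, ?_⟩
    have hmem : ∀ w, f w ∉ N → f w ∉ M k := fun w hw hwk => hw (mem_iUnion.2 ⟨k, hwk⟩)
    have hbits : ∀ b, ∃ w ∈ U ∩ {z | (f z).2 k = b}, (f w).1 = (f z).1 ∧ f w ∉ M k := by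
      intro b
      by_cases hb : (f z).2 k = b
      · exact ⟨z, ⟨hz, hb⟩, rfl, hmem _ hzN⟩
      · refine ⟨z', ⟨hz', ?_⟩, hpq.symm, hmem _ hzN'⟩
        simp only [mem_ofPred_eq]
        revert hb hk
        cases (f z).2 k <;> cases (f z').2 k <;> cases b <;> simp
    rintro W (rfl | rfl | hW)
    · exact hbits true
    · exact hbits false
    · obtain ⟨_, ⟨⟨w, hw, rfl⟩, hwN⟩, hwx⟩ := mem_iInter.1 hp ⟨W, mem_insert_of_mem _ hW⟩
      exact ⟨w, hw, hwx, hmem _ hwN⟩)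
  obtain ⟨x, hxx⟩ := h (N ∪ Q) (hNu.union (.of_injOn hQm hQi))
  obtain ⟨z, hz, rfl, hzn⟩ := hxx U (mem_insert _ _)
  refine hzn (Or.inr (hEQ ⟨⟨⟨z, hz, rfl⟩, fun h => hzn (Or.inl h)⟩, mem_iInter.2 ?_⟩))
  rintro ⟨W, hW⟩
  obtain ⟨w, hw, hwx, hwn⟩ := hxx W hW
  exact ⟨f w, ⟨⟨w, hw, rfl⟩, fun h => hwn (Or.inl h)⟩, hwx⟩

/-- `W true` and `W false` are Borel subsets of `U` on which the `n`-th coordinate is constant, and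
whose images under `f` have second components that are separated by some coordinate. -/
structure IsSplitting (f : (ℕ → ℕ) → Cantor × Cantor) (n : ℕ) (U : Set (ℕ → ℕ))
    (W : Bool → Set (ℕ → ℕ)) : Prop where
  subset : ∀ b, W b ⊆ U
  measurableSet : ∀ b, MeasurableSet (W b)
  coord : ∀ b, ∃ v, ∀ z ∈ W b, z n = v
  bit : ∃ k, ∀ b, ∀ z ∈ W b, (f z).2 k = b

theorem IsLarge.exists_isSplitting (hf : Continuous f) (n : ℕ) {F : Set (Set (ℕ → ℕ))}
    {U : Set (ℕ → ℕ)} (hF : F.Countable) (hFm : ∀ W ∈ F, MeasurableSet W) (hU : MeasurableSet U)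
    (h : IsLarge f (insert U F)) :
    ∃ W, IsSplitting f n U W ∧ IsLarge f (F ∪ range W) := by
  obtain ⟨k, hk⟩ := h.exists_split hf hF hFm hU
  have hcov : ∀ W : Set (ℕ → ℕ), W ⊆ ⋃ m, {z | z n = m} := fun W z _ => by simp
  obtain ⟨m, hm⟩ := hk.exists_piece _ (hcov _)
  rw [insert_comm] at hm
  obtain ⟨m', hm'⟩ := hm.exists_piece _ (hcov _)
  have hbit : ∀ b : Bool, MeasurableSet {z | (f z).2 k = b} := fun b =>
    measurableSet_eq_fun ((measurable_pi_apply k).comp (measurable_snd.comp hf.measurable))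
      measurable_const
  have hco : ∀ m : ℕ, MeasurableSet {z : ℕ → ℕ | z n = m} := fun m =>
    measurableSet_eq_fun (measurable_pi_apply n) measurable_const
  refine ⟨fun b => U ∩ {z | (f z).2 k = b} ∩ {z | z n = bif b then m else m'},
    ⟨fun b z hz => hz.1.1, fun b => (hU.inter (hbit b)).inter (hco _), fun b => ⟨_, fun z hz => hz.2⟩,
      k, fun b z hz => hz.1.2⟩, hm'.mono ?_⟩
  rintro W (hW | ⟨b, rfl⟩)
  · simp [hW]
  · cases b <;> simp

theorem IsLarge.exists_isSplitting_finset (hf : Continuous f) (n : ℕ) {ι : Type*} [DecidableEq ι]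
    (U : ι → Set (ℕ → ℕ)) (hU : ∀ i, MeasurableSet (U i)) (S : Finset ι) :
    ∀ F : Set (Set (ℕ → ℕ)), F.Countable → (∀ W ∈ F, MeasurableSet W) →
      IsLarge f (F ∪ U '' S) → ∃ W : ι → Bool → Set (ℕ → ℕ),
        (∀ i ∈ S, IsSplitting f n (U i) (W i)) ∧
        IsLarge f (F ∪ ⋃ i ∈ S, range (W i)) := by
  induction S using Finset.induction_on with
  | empty => intro F _ _ h; exact ⟨fun _ _ => ∅, by simp, by simpa using h⟩
  | insert a S ha ih =>
    intro F hF hFm h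
    obtain ⟨W, hW, hL⟩ := ih (insert (U a) F) (hF.insert _)
      (by rintro V (rfl | hV); exacts [hU a, hFm V hV])
      (h.mono (by
        rintro V ((rfl | hV) | ⟨i, hi, rfl⟩)
        · exact Or.inr ⟨a, by simp, rfl⟩
        · exact Or.inl hV
        · exact Or.inr ⟨i, by simp [Finset.mem_coe.1 hi], rfl⟩))
    rw [insert_union] at hL
    obtain ⟨Wa, hWa, hLa⟩ := hL.exists_isSplitting hf n
      (hF.union (S.countable_toSet.biUnion fun i _ => countable_range _))
      (by
        rintro V (hV | hV)
        · exact hFm V hV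
        · simp only [mem_iUnion, mem_range] at hV
          obtain ⟨i, hi, b, rfl⟩ := hV
          exact (hW i hi).measurableSet b) (hU a)
    have hne : ∀ i ∈ S, i ≠ a := fun i hi h => ha (h ▸ hi)
    refine ⟨Function.update W a Wa, ?_, hLa.mono ?_⟩
    · intro i hi
      rcases Finset.mem_insert.1 hi with rfl | hi
      · simpa using hWa
      · simpa [hne i hi] using hW i hi
    · rintro V (hV | hV)
      · exact Or.inl (Or.inl hV)
      · simp only [mem_iUnion] at hV
        obtain ⟨i, hi, hV⟩ := hV
        rcases Finset.mem_insert.1 hi with rfl | hi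
        · exact Or.inr (by simpa using hV)
        · rw [Function.update_of_ne (hne i hi)] at hV
          exact Or.inl (Or.inr (mem_iUnion₂.2 ⟨i, hi, hV⟩))

/-- A scheme of Borel sets, indexed by finite binary sequences, which is large at every level and
splits from every level to the next. -/
theorem IsLarge.exists_scheme (hf : Continuous f) (h : IsLarge f {univ}) :
    ∃ D : ℕ → List Bool → Set (ℕ → ℕ), (∀ n, IsLarge f (D n '' {s | s.length = n})) ∧
      ∀ n s, s.length = n → IsSplitting f n (D n s) fun b => D (n + 1) (b :: s) := by
  let P : ℕ → (List Bool → Set (ℕ → ℕ)) → Prop := fun n D =>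
    (∀ s, MeasurableSet (D s)) ∧ IsLarge f (D '' {s | s.length = n})
  have step : ∀ n (D : {D // P n D}), ∃ D' : {D // P (n + 1) D},
      ∀ s : List Bool, s.length = n → IsSplitting f n (D.1 s) fun b => D'.1 (b :: s) := by
    rintro n ⟨D, hDm, hD⟩
    obtain ⟨W, hW, hL⟩ := IsLarge.exists_isSplitting_finset hf n D hDm
      (List.finite_length_eq Bool n).toFinset ∅ countable_empty (by simp) (by simpa using hD)
    simp only [Finite.mem_toFinset, mem_ofPred_eq] at hW
    -- The newest bit is at the head of the list; the default `true` is never used, since the list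
    -- has length `n + 1`.
    refine ⟨⟨fun t => if t.length = n + 1 then W t.tail (t.headD true) else ∅, ?_, ?_⟩, ?_⟩
    · intro t
      dsimp only
      split_ifs with ht
      · exact (hW _ (by simp [ht])).measurableSet _
      · exact MeasurableSet.empty
    · refine hL.mono ?_
      rintro _ ⟨t, ht, rfl⟩
      simp only [mem_ofPred_eq] at ht
      simp only [ht, if_true]
      refine Or.inr (mem_iUnion₂.2 ⟨t.tail, by simp [ht], mem_range_self _⟩)
    · intro s hs
      simpa [hs] using hW s hs
  choose g hg using step
  let D : ∀ n, {D // P n D} := fun n => Nat.rec ⟨fun _ => univ, fun _ => MeasurableSet.univ,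
    h.mono (by rintro _ ⟨_, _, rfl⟩; rfl)⟩ (fun n D => g n D) n
  exact ⟨fun n => (D n).1, fun n => (D n).2.2, fun n s hs => hg n (D n) s hs⟩

/-- Each branch of the scheme fixes successive coordinates, so points chosen along it converge. At
every level all points are chosen over one common first coordinate, so the limits of all branches
have images in one section, where the separating bits keep them distinct. -/
theorem IsLarge.exists_not_countable_section (hf : Continuous f) (h : IsLarge f {univ}) :
    ∃ x, ¬ {y | (x, y) ∈ range f}.Countable := by
  obtain ⟨D, hL, hD⟩ := h.exists_scheme hf
  have hx : ∀ n, ∃ x : Cantor, ∀ s : List Bool, s.length = n → ∃ z ∈ D n s, (f z).1 = x := by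
    intro n
    obtain ⟨x, hx⟩ := hL n ∅ IsGraphUnion.empty
    refine ⟨x, fun s hs => ?_⟩
    obtain ⟨z, hz, hzx, -⟩ := hx _ ⟨s, hs, rfl⟩
    exact ⟨z, hz, hzx⟩
  choose x hx using hx
  choose z hz hzx using fun (c : Cantor) n => hx n (PiNat.res c n) (PiNat.res_length c n)
  have hsub : ∀ (c : Cantor) n m, n ≤ m → D m (PiNat.res c m) ⊆ D n (PiNat.res c n) := by
    intro c n m hnm
    induction m, hnm using Nat.le_induction with
    | base => exact subset_rfl
    | succ m _ ih =>
      rw [PiNat.res_succ]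
      exact ((hD m _ (PiNat.res_length c m)).subset (c m)).trans ih
  have hcoord : ∀ (c : Cantor) n m, n < m → z c m n = z c (n + 1) n := by
    intro c n m hnm
    obtain ⟨v, hv⟩ := (hD n _ (PiNat.res_length c n)).coord (c n)
    rw [← PiNat.res_succ] at hv
    rw [hv _ (hsub c (n + 1) m hnm (hz c m)), hv _ (hz c (n + 1))]
  let φ : Cantor → ℕ → ℕ := fun c n => z c (n + 1) n
  have hlim : ∀ c, Tendsto (fun m => z c m) atTop (𝓝 (φ c)) := fun c =>
    tendsto_pi_nhds.2 fun n => tendsto_const_nhds.congr'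
      ((eventually_gt_atTop n).mono fun m hm => (hcoord c n m hm).symm)
  have hflim : ∀ c, Tendsto (fun m => f (z c m)) atTop (𝓝 (f (φ c))) := fun c =>
    (hf.tendsto _).comp (hlim c)
  have hfst : ∀ c, Tendsto x atTop (𝓝 (f (φ c)).1) := fun c =>
    ((continuous_fst.tendsto _).comp (hflim c)).congr fun m => hzx c m
  let c₀ : Cantor := fun _ => true
  refine ⟨(f (φ c₀)).1, fun hcount => ?_⟩
  have hinj : Function.Injective fun c => (f (φ c)).2 := by
    intro c c' hcc
    by_contra hne
    have hex : ∃ n, c n ≠ c' n := Function.ne_iff.1 hne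
    classical
    set n := Nat.find hex with hn
    have hres : PiNat.res c n = PiNat.res c' n :=
      PiNat.res_eq_res.2 fun m hm => by simpa using Nat.find_min hex hm
    obtain ⟨k, hk⟩ := (hD n _ (PiNat.res_length c n)).bit
    have hval : ∀ e : Cantor, PiNat.res e n = PiNat.res c n → (f (φ e)).2 k = e n := by
      intro e he
      refine tendsto_nhds_unique (((continuous_apply k).tendsto _).comp
        ((continuous_snd.tendsto _).comp (hflim e))) (tendsto_const_nhds.congr' ?_)
      refine (eventually_gt_atTop n).mono fun m hm => (hk (e n) _ ?_).symm
      have := hsub e (n + 1) m hm (hz e m)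
      rwa [PiNat.res_succ, he] at this
    refine Nat.find_spec hex ?_
    rw [← hn, ← hval c rfl, ← hval c' hres.symm]
    exact congrFun hcc k
  have huniv : (univ : Set Cantor).Countable := by
    refine MapsTo.countable_of_injOn (f := fun c => (f (φ c)).2) (fun c _ => ?_) hinj.injOn hcount
    exact ⟨φ c, Prod.ext (tendsto_nhds_unique (hfst c) (hfst c₀)) rfl⟩
  rw [← Cardinal.le_aleph0_iff_set_countable] at huniv
  simp [Cardinal.aleph0_lt_continuum.not_ge] at huniv

/-- The **Lusin-Novikov theorem** in the square of the Cantor space. -/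
theorem exists_isGraphUnion_of_countable_section {P : Set (Cantor × Cantor)} (hP : AnalyticSet P)
    (hc : ∀ x, {y | (x, y) ∈ P}.Countable) : ∃ M, IsGraphUnion M ∧ P ⊆ M := by
  rw [AnalyticSet] at hP
  obtain rfl | ⟨f, hf, rfl⟩ := hP
  · exact ⟨∅, .empty, subset_rfl⟩
  by_contra! hcon
  obtain ⟨x, hx⟩ := IsLarge.exists_not_countable_section hf (fun M hM => by
    obtain ⟨p, ⟨z, rfl⟩, hz⟩ := Set.not_subset.1 (hcon M hM)
    exact ⟨(f z).1, by rintro U rfl; exact ⟨z, trivial, rfl, hz⟩⟩)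
  exact hx (hc x)

/-- A countable Borel equivalence relation is the union of the graphs of countably many Borel
functions. -/
theorem IsCountableBorelEquivOn.exists_enum {X : Type*} [MeasurableSpace X] [StandardBorelSpace X]
    {R : X → X → Prop} (hR : IsCountableBorelEquivOn univ R) :
    ∃ f : ℕ → X → X, (∀ n, Measurable (f n)) ∧ ∀ x y, R x y ↔ ∃ n, f n x = y := by
  classical
  let e : X → Cantor := MeasurableSpace.mapNatBool X
  have he : Measurable e := MeasurableSpace.measurable_mapNatBool X
  have hei : Function.Injective e := MeasurableSpace.injective_mapNatBool X
  have hee : Measurable (Prod.map e e) := he.prodMap he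
  obtain ⟨M, ⟨Q, hQ, hq, rfl⟩, hPM⟩ := exists_isGraphUnion_of_countable_section
    (P := Prod.map e e '' {p | R p.1 p.2}) (hR.measurableSet_graph.analyticSet_image hee) (by
      intro u
      by_cases hu : ∃ x, e x = u
      · obtain ⟨x, rfl⟩ := hu
        refine ((hR.countable_class x).image e).mono ?_
        rintro _ ⟨⟨a, b⟩, hab, hp⟩
        simp only [Prod.map_apply, Prod.mk.injEq] at hp
        obtain rfl := hei hp.1
        exact ⟨b, hab, hp.2⟩
      · convert countable_empty
        refine eq_empty_of_forall_notMem ?_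
        rintro _ ⟨⟨a, b⟩, -, hp⟩
        exact hu ⟨a, (Prod.mk.inj hp).1⟩)
  -- Inserting `∅` makes the family nonempty, so that it can be listed by `ℕ`.
  obtain ⟨q, hQq⟩ : ∃ q : ℕ → Set (Cantor × Cantor), insert ∅ Q = range q :=
    (hQ.insert ∅).exists_eq_range (insert_nonempty _ _)
  have hq' : ∀ n, MeasurableSet (q n) ∧ InjOn Prod.fst (q n) := by
    intro n
    have : q n ∈ insert ∅ Q := hQq ▸ mem_range_self n
    rcases this with h | h
    · simp [h]
    · exact hq _ h
  let G : ℕ → Set (X × X) := fun n => {p | R p.1 p.2} ∩ Prod.map e e ⁻¹' q n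
  have hGm : ∀ n, MeasurableSet (G n) := fun n =>
    hR.measurableSet_graph.inter (hee (hq' n).1)
  have hGi : ∀ n, InjOn Prod.fst (G n) := by
    rintro n ⟨x, y⟩ hp ⟨x', y'⟩ hp' h
    obtain rfl : x = x' := h
    have := (hq' n).2 hp.2 hp'.2 rfl
    exact Prod.ext rfl (hei (Prod.mk.inj this).2)
  have huniq : ∀ n x y y', (x, y) ∈ G n → (x, y') ∈ G n → y = y' := fun n x y y' h h' =>
    (Prod.mk.inj (hGi n h h' rfl)).2
  -- The default value `x` stays in the class of `x` by reflexivity.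
  let F : ℕ → X → X := fun n x => if h : ∃ y, (x, y) ∈ G n then h.choose else x
  have hF : ∀ n x y, (x, y) ∈ G n → F n x = y := by
    intro n x y h
    have hex : ∃ y, (x, y) ∈ G n := ⟨y, h⟩
    simp only [F, hex, dif_pos]
    exact huniq n x _ _ hex.choose_spec h
  refine ⟨F, fun n B hB => ?_, fun x y => ⟨fun h => ?_, ?_⟩⟩
  · have hm : ∀ C : Set (X × X), MeasurableSet C → MeasurableSet (Prod.fst '' (G n ∩ C)) :=
      fun C hC => ((hGm n).inter hC).image_of_measurable_injOn measurable_fst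
        ((hGi n).mono inter_subset_left)
    have : F n ⁻¹' B = Prod.fst '' (G n ∩ Prod.snd ⁻¹' B) ∪ ((Prod.fst '' (G n ∩ univ))ᶜ ∩ B) := by
      ext x
      simp only [mem_preimage, mem_union, mem_image, mem_inter_iff, Prod.exists, mem_univ,
        and_true, mem_compl_iff, exists_and_right, exists_eq_right, not_exists]
      by_cases hex : ∃ y, (x, y) ∈ G n
      · obtain ⟨y, hy⟩ := hex
        rw [hF n x y hy]
        constructor
        · exact fun h => Or.inl ⟨y, hy, h⟩
        · rintro (⟨y', hy', h⟩ | ⟨h, -⟩)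
          · rwa [huniq n x y y' hy hy']
          · exact absurd hy (h y)
      · have hFx : F n x = x := by simp [F, hex]
        rw [hFx]
        constructor
        · exact fun h => Or.inr ⟨fun y hy => hex ⟨y, hy⟩, h⟩
        · rintro (⟨y', hy', h⟩ | ⟨-, h⟩)
          · exact absurd ⟨y', hy'⟩ hex
          · exact h
    rw [this]
    exact (hm _ (measurable_snd hB)).union ((hm _ MeasurableSet.univ).compl.inter hB)
  · obtain ⟨s, hs, hxs⟩ := hPM ⟨(x, y), h, rfl⟩
    obtain ⟨n, rfl⟩ : s ∈ range q := hQq ▸ mem_insert_of_mem _ hs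
    exact ⟨n, hF n x y ⟨h, hxs⟩⟩
  · rintro ⟨n, rfl⟩
    by_cases hex : ∃ y, (x, y) ∈ G n
    · obtain ⟨y, hy⟩ := hex
      rw [hF n x y hy]
      exact hy.1
    · simp only [F, hex, dif_neg, not_false_eq_true]
      exact hR.refl (mem_univ x)

end LusinNovikov

end BER

open Set

namespace BER

/-! ### Free products and extension of cocycles -/

section Cocycles

/-- The ordered product of the increments of the potentials `g` along the first `n` steps of the
chain `x`, the `k`-th step being measured by the potential `g (j k)`. -/
def chainProd {X ι G : Type*} [Group G] (g : ι → X → G) : ℕ → (ℕ → X) → (ℕ → ι) → G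
  | 0, _, _ => 1
  | n + 1, x, j => g (j 0) (x 0) * (g (j 0) (x 1))⁻¹ *
      chainProd g n (fun k => x (k + 1)) (fun k => j (k + 1))

/-- The chain `x` of length `n` consists of nontrivial steps in the relations `r (j k)`, and
successive steps lie in different relations. -/
structure IsReducedChain {X ι : Type*} (r : ι → X → X → Prop) (n : ℕ) (x : ℕ → X) (j : ℕ → ι) :
    Prop where
  step : ∀ k < n, r (j k) (x k) (x (k + 1))
  ne : ∀ k < n, x k ≠ x (k + 1)
  index : ∀ k, k + 1 < n → j k ≠ j (k + 1)

theorem IsReducedChain.tail {X ι : Type*} {r : ι → X → X → Prop} {n : ℕ} {x : ℕ → X} {j : ℕ → ι}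
    (h : IsReducedChain r (n + 1) x j) :
    IsReducedChain r n (fun k => x (k + 1)) (fun k => j (k + 1)) :=
  ⟨fun k hk => h.step (k + 1) (by omega), fun k hk => h.ne (k + 1) (by omega),
    fun k hk => h.index (k + 1) (by omega)⟩

theorem IsReducedChain.cons {X ι : Type*} {r : ι → X → X → Prop} {n : ℕ} {x : ℕ → X} {j : ℕ → ι}
    (h : IsReducedChain r n x j) {a : X} {i : ι} (hr : r i a (x 0)) (hne : a ≠ x 0)
    (hi : 0 < n → i ≠ j 0) :
    IsReducedChain r (n + 1) (fun k => Nat.casesOn k a x) (fun k => Nat.casesOn k i j) := by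
  refine ⟨?_, ?_, ?_⟩
  · rintro (_ | k) hk
    exacts [hr, h.step k (by omega)]
  · rintro (_ | k) hk
    exacts [hne, h.ne k (by omega)]
  · rintro (_ | k) hk
    exacts [hi (by omega), h.index k (by omega)]

/-- `γ` is the product of the increments of the potentials `g` along some reduced chain
from `a` to `b`. -/
def HasHolonomy {X ι G : Type*} [Group G] (r : ι → X → X → Prop) (g : ι → X → G)
    (a b : X) (γ : G) : Prop :=
  ∃ n x j, IsReducedChain r n x j ∧ x 0 = a ∧ x n = b ∧ chainProd g n x j = γ

theorem HasHolonomy.refl {X ι G : Type*} [Group G] [Nonempty ι] (r : ι → X → X → Prop)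
    (g : ι → X → G) (a : X) : HasHolonomy r g a a 1 :=
  ⟨0, fun _ => a, fun _ => Classical.arbitrary ι, ⟨by simp, by simp, by simp⟩, rfl, rfl, rfl⟩

/-- Prepending one step to a reduced chain and reducing the outcome. -/
theorem HasHolonomy.cons {X ι G : Type*} [Group G] {r : ι → X → X → Prop} {g : ι → X → G}
    (htrans : ∀ i x y z, r i x y → r i y z → r i x z) {i : ι} {a b c : X} {γ : G}
    (h : HasHolonomy r g b c γ) (hr : r i a b) :
    HasHolonomy r g a c (g i a * (g i b)⁻¹ * γ) := by
  obtain ⟨n, x, j, hx, rfl, rfl, rfl⟩ := h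
  by_cases hab : a = x 0
  · subst hab
    exact ⟨n, x, j, hx, rfl, rfl, by simp⟩
  by_cases hi : 0 < n → i ≠ j 0
  · exact ⟨n + 1, _, _, hx.cons hr hab hi, rfl, rfl, rfl⟩
  obtain ⟨hn, rfl⟩ : 0 < n ∧ i = j 0 := by simpa using hi
  obtain ⟨n, rfl⟩ : ∃ m, n = m + 1 := ⟨n - 1, by omega⟩
  -- The new step has the index of the first one, so the two merge into a single step from `a` to `x
  -- 1`, which disappears when `a = x 1`.
  have hr' : r (j 0) a (x 1) := htrans _ _ _ _ hr (hx.step 0 (by omega))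
  by_cases hax : a = x 1
  · refine ⟨n, _, _, hx.tail, hax.symm, rfl, ?_⟩
    simp only [chainProd, hax]
    group
  · refine ⟨n + 1, _, _, hx.tail.cons hr' hax fun hn => hx.index 0 (by omega), rfl, rfl, ?_⟩
    change g (j 0) a * (g (j 0) (x 1))⁻¹ * chainProd g n (fun k => x (k + 1)) (fun k => j (k + 1)) =
      g (j 0) a * (g (j 0) (x 0))⁻¹ * (g (j 0) (x 0) * (g (j 0) (x 1))⁻¹ *
        chainProd g n (fun k => x (k + 1)) (fun k => j (k + 1)))
    group

theorem HasHolonomy.trans {X ι G : Type*} [Group G] {r : ι → X → X → Prop} {g : ι → X → G}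
    (htrans : ∀ i x y z, r i x y → r i y z → r i x z) {a b c : X} {γ δ : G}
    (h : HasHolonomy r g a b γ) (h' : HasHolonomy r g b c δ) : HasHolonomy r g a c (γ * δ) := by
  obtain ⟨n, x, j, hx, rfl, rfl, rfl⟩ := h
  induction n generalizing x j with
  | zero => simpa [chainProd] using h'
  | succ n ih =>
    have := (ih _ _ hx.tail h').cons htrans (hx.step 0 (by omega))
    simpa [chainProd, mul_assoc] using this

theorem HasHolonomy.symm {X ι G : Type*} [Group G] [Nonempty ι] {r : ι → X → X → Prop}
    {g : ι → X → G} (htrans : ∀ i x y z, r i x y → r i y z → r i x z)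
    (hsymm : ∀ i x y, r i x y → r i y x) {a b : X} {γ : G}
    (h : HasHolonomy r g a b γ) : HasHolonomy r g b a γ⁻¹ := by
  obtain ⟨n, x, j, hx, rfl, rfl, rfl⟩ := h
  induction n generalizing x j with
  | zero => simpa [chainProd] using HasHolonomy.refl r g (x 0)
  | succ n ih =>
    have h1 := (HasHolonomy.refl r g (x 0)).cons htrans (hsymm _ _ _ (hx.step 0 (by omega)))
    have := (ih _ _ hx.tail).trans htrans h1
    simpa [chainProd, mul_assoc] using this

/-- Potentials on the factors of a free product have increments that extend to a cocycle. -/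
theorem IsFreeProduct.exists_cocycle {X ι G : Type*} [MeasurableSpace X] [Group G] {D : Set X}
    {R : X → X → Prop} {E : ι → Set X} {r : ι → X → X → Prop} (h : IsFreeProduct D R E r)
    (g : ι → X → G) :
    ∃ c : X → X → G, (∀ x y z, R x y → R y z → c x z = c x y * c y z) ∧
      ∀ i x y, r i x y → c x y = g i x * (g i y)⁻¹ := by
  classical
  rcases isEmpty_or_nonempty ι with hι | hι
  · exact ⟨fun _ _ => 1, by simp, fun i => isEmptyElim i⟩
  have htrans : ∀ i x y z, r i x y → r i y z → r i x z := fun i x y z h1 h2 =>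
    (h.factor i).trans h1 h2
  have hsymm : ∀ i x y, r i x y → r i y x := fun i x y h1 => (h.factor i).symm h1
  have hclosed : ∀ a γ, HasHolonomy r g a a γ → γ = 1 := by
    rintro a γ ⟨n, x, j, hx, hxa, hxn, rfl⟩
    rcases Nat.eq_zero_or_pos n with rfl | hn
    · rfl
    · obtain ⟨k, hk, hkk⟩ := h.reduced n x j hn hx.step hx.index (hxn.trans hxa.symm)
      exact absurd hkk (hx.ne k hk)
  have huniq : ∀ a b γ δ, HasHolonomy r g a b γ → HasHolonomy r g a b δ → γ = δ := by
    intro a b γ δ h1 h2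
    exact mul_inv_eq_one.1 (hclosed a _ (h1.trans htrans (h2.symm htrans hsymm)))
  have hstep : ∀ i x y, r i x y → HasHolonomy r g x y (g i x * (g i y)⁻¹) := fun i x y hr => by
    simpa using (HasHolonomy.refl r g y).cons htrans hr
  have hex : ∀ x y, R x y → ∃ γ, HasHolonomy r g x y γ := by
    intro x y hxy
    have := ((h.generates x y).1 hxy).2.2
    clear hxy
    induction this with
    | rel x y hr => obtain ⟨i, hr⟩ := hr; exact ⟨_, hstep i x y hr⟩
    | refl x => exact ⟨1, .refl r g x⟩
    | symm x y _ ih => obtain ⟨γ, hγ⟩ := ih; exact ⟨_, hγ.symm htrans hsymm⟩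
    | trans x y z _ _ ih1 ih2 =>
      obtain ⟨γ, hγ⟩ := ih1
      obtain ⟨δ, hδ⟩ := ih2
      exact ⟨_, hγ.trans htrans hδ⟩
  let c : X → X → G := fun x y => if hxy : ∃ γ, HasHolonomy r g x y γ then hxy.choose else 1
  have hc : ∀ x y γ, HasHolonomy r g x y γ → c x y = γ := by
    intro x y γ hγ
    have hγ' : ∃ γ, HasHolonomy r g x y γ := ⟨γ, hγ⟩
    simp only [c, hγ', dif_pos]
    exact huniq x y _ _ hγ'.choose_spec hγ
  refine ⟨c, fun x y z hxy hyz => ?_, fun i x y hr => hc _ _ _ (hstep i x y hr)⟩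
  obtain ⟨γ, hγ⟩ := hex x y hxy
  obtain ⟨δ, hδ⟩ := hex y z hyz
  rw [hc _ _ _ hγ, hc _ _ _ hδ, hc _ _ _ (hγ.trans htrans hδ)]

/-- A product of increments of injective potentials with values in different factors of a free
product of groups, along a nonempty reduced chain, is nontrivial. -/
theorem chainProd_of_ne_one {X ι : Type*} {r : ι → X → X → Prop} {n : ℕ} {x : ℕ → X}
    {j : ℕ → ι} (hx : IsReducedChain r n x j) (hn : 0 < n) :
    chainProd (fun i x => (Monoid.CoprodI.of (M := fun _ : ι => FreeGroup X) (i := i)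
      (FreeGroup.of x))) n x j ≠ 1 := by
  classical
  -- Tracking the list of indices gives what the induction needs to prepend a letter, and at the end
  -- shows that the word is nonempty.
  have key : ∃ w : Monoid.CoprodI.Word (fun _ : ι => FreeGroup X),
      w.prod = chainProd (fun i x => (Monoid.CoprodI.of (M := fun _ : ι => FreeGroup X) (i := i)
      (FreeGroup.of x))) n x j ∧ w.toList.map Sigma.fst = (List.range n).map j := by
    clear hn
    induction n generalizing x j with
    | zero => exact ⟨Monoid.CoprodI.Word.empty, rfl, rfl⟩
    | succ n ih =>
      obtain ⟨w, hw, hl⟩ := ih hx.tail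
      have hne : FreeGroup.of (x 0) * (FreeGroup.of (x 1))⁻¹ ≠ 1 := fun h =>
        hx.ne 0 (by omega) (FreeGroup.of_injective (mul_inv_eq_one.1 h))
      refine ⟨⟨⟨j 0, FreeGroup.of (x 0) * (FreeGroup.of (x 1))⁻¹⟩ :: w.toList, ?_, ?_⟩, ?_, ?_⟩
      · rintro l hl
        rcases List.mem_cons.1 hl with rfl | hl
        exacts [hne, w.ne_one l hl]
      · refine List.IsChain.cons w.chain_ne ?_
        intro y hy
        have h1 : (w.toList.map Sigma.fst).head? = some y.1 := by
          rw [List.head?_map, hy, Option.map_some]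
        rw [hl] at h1
        cases n with
        | zero => simp at h1
        | succ n =>
          simp [List.range_succ_eq_map] at h1
          rw [← h1]
          exact hx.index 0 (by omega)
      · simp only [Monoid.CoprodI.Word.prod, chainProd, List.map_cons, List.prod_cons, map_mul,
          map_inv] at hw ⊢
        rw [hw]
      · simp [hl, List.range_succ_eq_map, Function.comp_def]
  obtain ⟨w, hw, hl⟩ := key
  intro h1
  rw [← hw, ← Monoid.CoprodI.Word.prod_empty] at h1
  have : w = Monoid.CoprodI.Word.empty := Monoid.CoprodI.Word.equiv.symm.injective h1
  subst this
  have := congrArg List.length hl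
  simp [Monoid.CoprodI.Word.empty] at this
  omega

/-- If the increments of arbitrary potentials on the relations `r j` extend to cocycles on `R`,
then closed chains in the `r j` have trivial steps or repeated indices. -/
theorem exists_trivial_step_of_exists_cocycle {X ι : Type*} {R : X → X → Prop}
    {r : ι → X → X → Prop} (hsub : ∀ i x y, r i x y → R x y)
    (htrans : ∀ x y z, R x y → R y z → R x z)
    (hext : ∀ g : ι → X → Monoid.CoprodI (fun _ : ι => FreeGroup X),
      ∃ c : X → X → Monoid.CoprodI (fun _ : ι => FreeGroup X),
        (∀ x y z, R x y → R y z → c x z = c x y * c y z) ∧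
        ∀ i x y, r i x y → c x y = g i x * (g i y)⁻¹)
    (n : ℕ) (x : ℕ → X) (j : ℕ → ι) (hn : 0 < n)
    (hstep : ∀ k < n, r (j k) (x k) (x (k + 1))) (hj : ∀ k, k + 1 < n → j k ≠ j (k + 1))
    (hclosed : x n = x 0) : ∃ k < n, x k = x (k + 1) := by
  by_contra! hne
  set g : ι → X → Monoid.CoprodI (fun _ : ι => FreeGroup X) :=
    fun i x => Monoid.CoprodI.of (i := i) (FreeGroup.of x) with hg
  obtain ⟨c, hc, hcr⟩ := hext g
  have key : ∀ n x j, (∀ k < n + 1, r (j k) (x k) (x (k + 1))) →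
      R (x 0) (x (n + 1)) ∧ chainProd g (n + 1) x j = c (x 0) (x (n + 1)) := by
    intro n
    induction n with
    | zero =>
      intro x j hs
      refine ⟨hsub _ _ _ (hs 0 (by omega)), ?_⟩
      rw [hcr _ _ _ (hs 0 (by omega))]
      simp [chainProd]
    | succ n ih =>
      intro x j hs
      obtain ⟨h1, h2⟩ := ih (fun k => x (k + 1)) (fun k => j (k + 1))
        fun k hk => hs (k + 1) (by omega)
      have h0 := hs 0 (by omega)
      refine ⟨htrans _ _ _ (hsub _ _ _ h0) h1, ?_⟩
      rw [chainProd, h2, ← hcr _ _ _ h0, ← hc _ _ _ (hsub _ _ _ h0) h1]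
  obtain ⟨m, rfl⟩ : ∃ m, n = m + 1 := ⟨n - 1, by omega⟩
  obtain ⟨h1, h2⟩ := key m x j hstep
  rw [hclosed] at h1 h2
  refine chainProd_of_ne_one ⟨hstep, hne, hj⟩ hn (h2.trans ?_)
  have := hc _ _ _ h1 h1
  exact left_eq_mul.1 this

end Cocycles

end BER

open Set

namespace BER

/-! ### Retractions onto `A` and the resulting free decomposition -/

section RetractionSystem

/-- A system of maps that pushes the saturation of `A` back onto `A` along the factors `R' i`.
Points outside `A` have a parent in a common class of some factor, and `proj` follows the parents
down to `A`. Every `R' i`-class in the saturation meets exactly one of the sets `piece i k`, on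
which `proj` is injective, and `retract i` moves its points into that set. -/
structure RetractionSystem {X I : Type*} (R : X → X → Prop) (A' : I → Set X)
    (R' : I → X → X → Prop) (A : Set X) where
  parent : X → X
  rank : X → ℕ
  proj : X → X
  piece : I → ℕ → Set X
  retract : I → X → X
  exists_rel_parent : ∀ x ∈ saturation R A, x ∉ A → ∃ i, R' i x (parent x)
  rank_parent_lt : ∀ x ∈ saturation R A, x ∉ A → rank (parent x) < rank x
  proj_of_mem : ∀ x ∈ A, proj x = x
  proj_parent : ∀ x ∈ saturation R A, x ∉ A → proj (parent x) = proj x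
  piece_subset : ∀ i k, piece i k ⊆ A' i ∩ saturation R A
  index_unique : ∀ i k l, ∀ x ∈ piece i k, ∀ y ∈ piece i l, R' i x y → k = l
  injOn_proj : ∀ i k, InjOn proj (piece i k)
  rel_retract : ∀ i, ∀ x ∈ A' i ∩ saturation R A, R' i x (retract i x)
  retract_mem : ∀ i, ∀ x ∈ A' i ∩ saturation R A, ∃ k, retract i x ∈ piece i k
  retract_of_mem : ∀ i k, ∀ x ∈ piece i k, retract i x = x
  retract_parent : ∀ i, ∀ x ∈ saturation R A, x ∉ A → R' i x (parent x) →
    retract i (parent x) = retract i x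

namespace RetractionSystem

variable {X I : Type*} {R : X → X → Prop} {A' : I → Set X} {R' : I → X → X → Prop} {A : Set X}
  (P : RetractionSystem R A' R' A)

/-- The relation that `proj` induces on the image of `piece i k` from the relation `R' i`. -/
def factor (i : I) (k : ℕ) (a b : X) : Prop :=
  ∃ z ∈ P.piece i k, ∃ z' ∈ P.piece i k, P.proj z = a ∧ P.proj z' = b ∧ R' i z z'

/-- The oriented edges between the projections of a point and of its image under `retract i`. -/
def edge (a b : X) : Prop :=
  ∃ i, ∃ x ∈ A' i ∩ saturation R A, P.proj x = a ∧ P.proj (P.retract i x) = b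

/-- The graph of all edges that are not loops. -/
def graph : SimpleGraph X := SimpleGraph.fromRel P.edge

/-- The equivalence relation on `A` whose classes are the connected components of `graph`. -/
def tree (a b : X) : Prop := a ∈ A ∧ b ∈ A ∧ P.graph.Reachable a b

variable [MeasurableSpace X] (hR : IsCountableBorelEquivOn univ R)
  (hfree : IsFreeProduct univ R A' R')

include hR in
theorem _root_.BER.mem_saturation_of_rel {x y : X} (hx : x ∈ saturation R A) (h : R x y) :
    y ∈ saturation R A := by
  obtain ⟨a, ha, hax⟩ := hx
  exact ⟨a, ha, hR.trans hax h⟩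

include hR in
theorem _root_.BER.subset_saturation : A ⊆ saturation R A :=
  fun a ha => ⟨a, ha, hR.refl trivial⟩

include hR hfree in
theorem proj_induction {p : X → Prop} (hA : ∀ x ∈ A, p x)
    (hp : ∀ i, ∀ x ∈ saturation R A, x ∉ A → R' i x (P.parent x) → p (P.parent x) → p x) :
    ∀ x ∈ saturation R A, p x := by
  intro x hx
  induction h : P.rank x using Nat.strong_induction_on generalizing x with
  | _ n ih =>
    by_cases hxA : x ∈ A
    · exact hA x hxA
    obtain ⟨i, hi⟩ := P.exists_rel_parent x hx hxA
    refine hp i x hx hxA hi (ih _ (h ▸ P.rank_parent_lt x hx hxA) _ ?_ rfl)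
    exact mem_saturation_of_rel hR hx (hfree.subrelation _ _ _ hi)

include hR hfree in
theorem proj_mem_and_rel : ∀ x ∈ saturation R A, P.proj x ∈ A ∧ R x (P.proj x) := by
  refine P.proj_induction hR hfree (fun x hx => ?_) fun i x hx hxA hi ih => ?_
  · rw [P.proj_of_mem x hx]
    exact ⟨hx, hR.refl trivial⟩
  · rw [← P.proj_parent x hx hxA]
    exact ⟨ih.1, hR.trans (hfree.subrelation _ _ _ hi) ih.2⟩

include hR hfree in
theorem mem_and_rel_of_edge {a b : X} (h : P.edge a b) : a ∈ A ∧ b ∈ A ∧ R a b := by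
  obtain ⟨i, x, hx, rfl, rfl⟩ := h
  have hxr := hfree.subrelation _ _ _ (P.rel_retract i x hx)
  have h1 := P.proj_mem_and_rel hR hfree x hx.2
  have h2 := P.proj_mem_and_rel hR hfree _ (mem_saturation_of_rel hR hx.2 hxr)
  exact ⟨h1.1, h2.1, hR.trans (hR.symm h1.2) (hR.trans hxr h2.2)⟩

include hR hfree in
theorem mem_and_rel_of_adj {a b : X} (h : P.graph.Adj a b) : a ∈ A ∧ b ∈ A ∧ R a b := by
  obtain ⟨-, h | h⟩ := (SimpleGraph.fromRel_adj _ _ _).1 h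
  · exact P.mem_and_rel_of_edge hR hfree h
  · obtain ⟨h1, h2, h3⟩ := P.mem_and_rel_of_edge hR hfree h
    exact ⟨h2, h1, hR.symm h3⟩

include hR hfree in
theorem rel_of_factor {i : I} {k : ℕ} {a b : X} (h : P.factor i k a b) : a ∈ A ∧ b ∈ A ∧ R a b := by
  obtain ⟨z, hz, z', hz', rfl, rfl, hzz⟩ := h
  have h1 := P.proj_mem_and_rel hR hfree z (P.piece_subset i k hz).2
  have h2 := P.proj_mem_and_rel hR hfree z' (P.piece_subset i k hz').2
  exact ⟨h1.1, h2.1, hR.trans (hR.symm h1.2) (hR.trans (hfree.subrelation _ _ _ hzz) h2.2)⟩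

include hR in
theorem rel_of_reachable {H : SimpleGraph X} (hH : ∀ a b, H.Adj a b → R a b) {a b : X}
    (h : H.Reachable a b) : R a b := by
  obtain ⟨p⟩ := h
  induction p with
  | nil => exact hR.refl trivial
  | cons hadj _ ih => exact hR.trans (hH _ _ hadj) ih

-- A step from `x` to `y` in `R' i` projects to an edge from `proj x`, a factor step between the
-- projected retractions, and a reversed edge to `proj y`. The two retractions share a piece by
-- `index_unique`.
include hR hfree in
theorem proj_rel_eqvGen {r : X → X → Prop} (hr : ∀ i k a b, P.factor i k a b → r a b)
    (hT : ∀ a b, P.tree a b → r a b) {x y : X} (hx : x ∈ saturation R A) (h : R x y) :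
    Relation.EqvGen r (P.proj x) (P.proj y) := by
  have hedge : ∀ a b, P.edge a b → Relation.EqvGen r a b := by
    intro a b hab
    obtain ⟨ha, hb, -⟩ := P.mem_and_rel_of_edge hR hfree hab
    refine .rel _ _ (hT _ _ ⟨ha, hb, ?_⟩)
    by_cases hne : a = b
    · rw [hne]
    · exact SimpleGraph.Adj.reachable ((SimpleGraph.fromRel_adj _ _ _).2 ⟨hne, Or.inl hab⟩)
  have hstep : ∀ i x y, x ∈ saturation R A → R' i x y →
      Relation.EqvGen r (P.proj x) (P.proj y) := by
    intro i x y hx hxy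
    have hy := mem_saturation_of_rel hR hx (hfree.subrelation _ _ _ hxy)
    have hxm : x ∈ A' i ∩ saturation R A := ⟨((hfree.factor i).mem_domain hxy).1, hx⟩
    have hym : y ∈ A' i ∩ saturation R A := ⟨((hfree.factor i).mem_domain hxy).2, hy⟩
    have hrel : R' i (P.retract i x) (P.retract i y) :=
      (hfree.factor i).trans ((hfree.factor i).symm (P.rel_retract i x hxm))
        ((hfree.factor i).trans hxy (P.rel_retract i y hym))
    obtain ⟨k, hk⟩ := P.retract_mem i x hxm
    obtain ⟨l, hl⟩ := P.retract_mem i y hym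
    obtain rfl := P.index_unique i k l _ hk _ hl hrel
    exact .trans _ _ _ (hedge _ _ ⟨i, x, hxm, rfl, rfl⟩)
      (.trans _ _ _ (.rel _ _ (hr i k _ _ ⟨_, hk, _, hl, rfl, rfl, hrel⟩))
        (.symm _ _ (hedge _ _ ⟨i, y, hym, rfl, rfl⟩)))
  have hgen := ((hfree.generates x y).1 h).2.2
  have hmain : ∀ x y, Relation.EqvGen (fun a b => ∃ j, R' j a b) x y →
      R x y ∧ (x ∈ saturation R A → Relation.EqvGen r (P.proj x) (P.proj y)) := by
    intro x y hxy
    refine ⟨(hfree.generates x y).2 ⟨trivial, trivial, hxy⟩, ?_⟩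
    induction hxy with
    | rel x y h => obtain ⟨i, hi⟩ := h; exact fun hx => hstep i x y hx hi
    | refl x => exact fun _ => .refl _
    | symm x y h ih =>
      exact fun hy => .symm _ _ (ih (mem_saturation_of_rel hR hy
        (hR.symm ((hfree.generates x y).2 ⟨trivial, trivial, h⟩))))
    | trans x y z h _ ih1 ih2 =>
      exact fun hx => .trans _ _ _ (ih1 hx) (ih2 (mem_saturation_of_rel hR hx
        ((hfree.generates x y).2 ⟨trivial, trivial, h⟩)))
  exact (hmain x y hgen).2 hx

include hR hfree in
/-- Potentials on the factors and an antisymmetric function on the edges extend to a cocycle. -/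
theorem exists_cocycle {G : Type*} [Group G] (h : I → ℕ → X → G) (w : X → X → G)
    (hw : ∀ a b, w b a = (w a b)⁻¹) (hw1 : ∀ a, w a a = 1) :
    ∃ c : X → X → G, (∀ x y z, R x y → R y z → c x z = c x y * c y z) ∧
      (∀ i k a b, P.factor i k a b → c a b = h i k a * (h i k b)⁻¹) ∧
      ∀ a b, P.graph.Adj a b → c a b = w a b := by
  classical
  have hκ : ∀ i x, ∃ k, x ∈ A' i ∩ saturation R A → P.retract i x ∈ P.piece i k := by
    intro i x
    by_cases hx : x ∈ A' i ∩ saturation R A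
    · obtain ⟨k, hk⟩ := P.retract_mem i x hx
      exact ⟨k, fun _ => hk⟩
    · exact ⟨0, fun h => absurd h hx⟩
  choose κ hκ using hκ
  have hκu : ∀ i k, ∀ z ∈ P.piece i k, κ i z = k := by
    intro i k z hz
    have hzm := P.piece_subset i k hz
    have := hκ i z hzm
    rw [P.retract_of_mem i k z hz] at this
    exact P.index_unique i _ _ z this z hz ((hfree.factor i).refl hzm.1)
  have hκr : ∀ i, ∀ x ∈ A' i ∩ saturation R A, κ i (P.retract i x) = κ i x := fun i x hx =>
    hκu i _ _ (hκ i x hx)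
  -- The potential at `x` is the weight of the edge from `proj x` to its projected retraction, times
  -- the prescribed factor potential there.
  obtain ⟨c, hc, hcg⟩ := hfree.exists_cocycle (G := G) fun i x =>
    w (P.proj x) (P.proj (P.retract i x)) * h i (κ i x) (P.proj (P.retract i x))
  have hc1 : ∀ x, c x x = 1 := fun x =>
    left_eq_mul.1 (hc x x x (hR.refl trivial) (hR.refl trivial))
  have hcs : ∀ x y, R x y → c y x = (c x y)⁻¹ := fun x y hxy => by
    rw [eq_inv_iff_mul_eq_one, ← hc _ _ _ (hR.symm hxy) hxy, hc1]
  -- A point and its parent have the same projection and, in the factor of the parent step, the same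
  -- retraction; hence the same potential, and the increment is trivial.
  have hcp : ∀ x ∈ saturation R A, c x (P.proj x) = 1 := by
    refine P.proj_induction hR hfree (fun x hx => ?_) fun i x hx hxA hi ih => ?_
    · rw [P.proj_of_mem x hx, hc1]
    · have hxp := hfree.subrelation _ _ _ hi
      have hpm := mem_saturation_of_rel hR hx hxp
      have hd := (hfree.factor i).mem_domain hi
      have hκp : κ i (P.parent x) = κ i x := by
        rw [← hκr i _ ⟨hd.2, hpm⟩, P.retract_parent i x hx hxA hi, hκr i x ⟨hd.1, hx⟩]
      rw [← P.proj_parent x hx hxA,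
        hc _ _ _ hxp (P.proj_mem_and_rel hR hfree _ hpm).2, ih, mul_one, hcg i _ _ hi,
        P.retract_parent i x hx hxA hi, P.proj_parent x hx hxA, hκp, mul_inv_cancel]
  have hcpp : ∀ x y, x ∈ saturation R A → R x y → c (P.proj x) (P.proj y) = c x y := by
    intro x y hx hxy
    have hy := mem_saturation_of_rel hR hx hxy
    have hpx := (P.proj_mem_and_rel hR hfree x hx).2
    have hpy := (P.proj_mem_and_rel hR hfree y hy).2
    rw [hc _ _ _ (hR.symm hpx) (hR.trans hxy hpy), hc _ _ _ hxy hpy, hcp y hy, hcs _ _ hpx,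
      hcp x hx]
    simp
  have hcedge : ∀ a b, P.edge a b → c a b = w a b := by
    rintro a b ⟨i, x, hx, rfl, rfl⟩
    have hxr := P.rel_retract i x hx
    obtain ⟨k, hk⟩ := P.retract_mem i x hx
    rw [hcpp _ _ hx.2 (hfree.subrelation _ _ _ hxr), hcg i _ _ hxr, hκr i x hx,
      P.retract_of_mem i k _ hk, hw1]
    simp
  refine ⟨c, hc, ?_, ?_⟩
  · rintro i k a b ⟨z, hz, z', hz', rfl, rfl, hzz⟩
    rw [hcpp _ _ (P.piece_subset i k hz).2 (hfree.subrelation _ _ _ hzz), hcg i _ _ hzz,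
      hκu i k z hz, hκu i k z' hz', P.retract_of_mem i k z hz, P.retract_of_mem i k z' hz', hw1,
      hw1]
    simp
  · intro a b hab
    obtain ⟨-, h | h⟩ := (SimpleGraph.fromRel_adj _ _ _).1 hab
    · exact hcedge a b h
    · rw [hcs b a (P.mem_and_rel_of_edge hR hfree h).2.2, hcedge b a h, hw a b, inv_inv]

-- Every edge is a bridge: give the edge from `u` to `v` weight one in ℤ and all other edges, up to
-- orientation, weight zero. The extended cocycle vanishes along walks avoiding that edge, but not
-- on `(u, v)`.
include hR hfree in
theorem isAcyclic_graph : P.graph.IsAcyclic := by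
  classical
  refine SimpleGraph.isAcyclic_iff_forall_adj_isBridge.2 fun u v huv => ?_
  rw [SimpleGraph.isBridge_iff]
  intro hreach
  have hne : u ≠ v := huv.ne
  obtain ⟨c, hc, -, hcw⟩ := P.exists_cocycle hR hfree (G := Multiplicative ℤ) (fun _ _ _ => 1)
    (fun a b => if a = u ∧ b = v then Multiplicative.ofAdd 1 else
      if a = v ∧ b = u then (Multiplicative.ofAdd 1)⁻¹ else 1)
    (by
      intro a b
      by_cases h1 : a = u ∧ b = v
      · obtain ⟨rfl, rfl⟩ := h1
        simp [hne.symm]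
      · by_cases h2 : a = v ∧ b = u
        · obtain ⟨rfl, rfl⟩ := h2
          simp [hne.symm]
        · simp [h1, h2, and_comm (a := b = u), and_comm (a := b = v)])
    (by
      intro a
      have h1 : ¬ (a = u ∧ a = v) := fun h => hne (h.1.symm.trans h.2)
      have h2 : ¬ (a = v ∧ a = u) := fun h => hne (h.2.symm.trans h.1)
      simp [h1, h2])
  have huv1 : c u v = Multiplicative.ofAdd 1 := by simp [hcw u v huv]
  have hone : ∀ a b, (P.graph.deleteEdges {s(u, v)}).Reachable a b → c a b = 1 := by
    rintro a b ⟨p⟩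
    induction p with
    | @nil a => exact left_eq_mul.1 (hc a a a (hR.refl trivial) (hR.refl trivial))
    | @cons a b d hadj q ih =>
      rw [SimpleGraph.deleteEdges_adj] at hadj
      have hbd : R b d := rel_of_reachable hR (fun a b hab =>
        (P.mem_and_rel_of_adj hR hfree ((SimpleGraph.deleteEdges_adj.1 hab).1)).2.2) ⟨q⟩
      rw [hc a b d (P.mem_and_rel_of_adj hR hfree hadj.1).2.2 hbd, ih, hcw a b hadj.1]
      have h1 : ¬ (a = u ∧ b = v) := by
        rintro ⟨rfl, rfl⟩
        simp at hadj
      have h2 : ¬ (a = v ∧ b = u) := by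
        rintro ⟨rfl, rfl⟩
        simp [Sym2.eq_swap] at hadj
      simp [h1, h2]
  have := (hone u v hreach).symm.trans huv1
  exact absurd (congrArg Multiplicative.toAdd this) (by simp)

include hR hfree in
/-- The restriction of `R` to `A` is the free product of the factors and of the tree relation,
when the factors are indexed by the nonempty pieces. -/
theorem isFreeProduct {K : I → Type*} (ν : ∀ i, K i → ℕ) (hν : ∀ i, Function.Injective (ν i))
    (hν' : ∀ i k, (P.piece i k).Nonempty → k ∈ range (ν i))
    {E : Option (Σ i, K i) → Set X} {r : Option (Σ i, K i) → X → X → Prop}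
    (hE : ∀ j, IsCountableBorelEquivOn (E j) (r j)) (hr0 : ∀ a b, r none a b ↔ P.tree a b)
    (hr1 : ∀ i k a b, r (some ⟨i, k⟩) a b ↔ P.factor i (ν i k) a b) :
    IsFreeProduct A (restr R A) E r := by
  classical
  have hsub : ∀ j x y, r j x y → restr R A x y := by
    rintro (_ | ⟨i, k⟩) x y hxy
    · obtain ⟨hx, hy, h⟩ := (hr0 x y).1 hxy
      exact ⟨hx, hy, rel_of_reachable hR
        (fun a b hab => (P.mem_and_rel_of_adj hR hfree hab).2.2) h⟩
    · exact P.rel_of_factor hR hfree ((hr1 i k x y).1 hxy)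
  refine ⟨hE, hsub, fun x y => ⟨fun ⟨hx, hy, hxy⟩ => ⟨hx, hy, ?_⟩, ?_⟩, ?_⟩
  · have := P.proj_rel_eqvGen hR hfree (r := fun a b => ∃ j, r j a b) (fun i k a b hab => ?_)
      (fun a b hab => ⟨none, (hr0 a b).2 hab⟩) (subset_saturation hR hx) hxy
    · rwa [P.proj_of_mem x hx, P.proj_of_mem y hy] at this
    · obtain ⟨z, hz, -⟩ := id hab
      obtain ⟨k, rfl⟩ := hν' i k ⟨z, hz⟩
      exact ⟨some ⟨i, k⟩, (hr1 i k a b).2 hab⟩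
  · rintro ⟨hx, hy, hxy⟩
    refine ⟨hx, hy, ?_⟩
    clear hx hy
    induction hxy with
    | rel x y h => obtain ⟨j, hj⟩ := h; exact (hsub j x y hj).2.2
    | refl x => exact hR.refl trivial
    | symm x y _ ih => exact hR.symm ih
    | trans x y z _ _ ih1 ih2 => exact hR.trans ih1 ih2
  · refine exists_trivial_step_of_exists_cocycle (R := R) (fun j x y h => (hsub j x y h).2.2)
      (fun x y z h h' => hR.trans h h') fun g => ?_
    -- The potential of the tree factor enters as edge weights; these are increments, so they
    -- telescope along walks and give the right value on all of `tree`.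
    obtain ⟨c, hc, hcf, hcw⟩ := P.exists_cocycle hR hfree
      (fun i k => if hk : k ∈ range (ν i) then g (some ⟨i, hk.choose⟩) else 1)
      (fun a b => g none a * (g none b)⁻¹) (by simp) (by simp)
    refine ⟨c, hc, ?_⟩
    rintro (_ | ⟨i, k⟩) x y hxy
    · obtain ⟨-, -, ⟨p⟩⟩ := (hr0 x y).1 hxy
      clear hxy
      induction p with
      | @nil a =>
        rw [mul_inv_cancel]
        exact left_eq_mul.1 (hc a a a (hR.refl trivial) (hR.refl trivial))
      | @cons a b d hadj q ih =>
        have hbd : R b d := rel_of_reachable hR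
          (fun a b hab => (P.mem_and_rel_of_adj hR hfree hab).2.2) ⟨q⟩
        rw [hc a b d (P.mem_and_rel_of_adj hR hfree hadj).2.2 hbd, ih, hcw a b hadj]
        group
    · have hk : ν i k ∈ range (ν i) := mem_range_self k
      have := hcf i _ x y ((hr1 i k x y).1 hxy)
      rwa [dif_pos hk, hν i hk.choose_spec] at this

end RetractionSystem

end RetractionSystem

end BER

open Set

namespace BER

/-! ### Borel construction of a retraction system -/

section BorelConstruction

/-- A countable family of Borel functions admits a Borel selection of values that satisfy a
Borel condition wherever some member of the family does. -/
theorem exists_measurable_selection {X : Type*} [MeasurableSpace X] {f : ℕ → X → X}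
    (hf : ∀ n, Measurable (f n)) {p : ℕ → X → Prop} (hp : ∀ n, MeasurableSet {x | p n x}) :
    ∃ F : X → X, Measurable F ∧ ∀ x, (∃ n, p n x) → ∃ n, F x = f n x ∧ p n x := by
  classical
  have hex : ∀ x, ∃ n, p n x ∨ ¬ ∃ m, p m x := by
    intro x
    by_cases h : ∃ m, p m x
    · exact h.imp fun n hn => Or.inl hn
    · exact ⟨0, Or.inr h⟩
  refine ⟨fun x => f (Nat.find (hex x)) x, Measurable.find hf (fun n => ?_) hex, fun x hx => ?_⟩
  · have h1 : MeasurableSet {x | ∃ m, p m x} := by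
      simpa only [ofPred_exists] using MeasurableSet.iUnion hp
    exact (hp n).union h1.compl
  · exact ⟨_, rfl, (Nat.find_spec (hex x)).resolve_right (not_not.2 hx)⟩

theorem measurableSet_rel_comp {X Y : Type*} [MeasurableSpace X] [MeasurableSpace Y] {D : Set X}
    {r : X → X → Prop} (hr : IsCountableBorelEquivOn D r) {F G : Y → X} (hF : Measurable F)
    (hG : Measurable G) : MeasurableSet {y | r (F y) (G y)} :=
  (hF.prodMk hG) hr.measurableSet_graph

variable {X : Type*} [MeasurableSpace X] {I : Type*} {R : X → X → Prop}
  {A' : I → Set X} {R' : I → X → X → Prop} {A : Set X} {f : ℕ → X → X}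

theorem saturation_eq_iUnion_preimage (hR : IsCountableBorelEquivOn univ R)
    (hfR : ∀ x y, R x y ↔ ∃ n, f n x = y) (B : Set X) {r : X → X → Prop}
    (hrR : ∀ x y, r x y → R x y) :
    saturation r B = ⋃ n, {y | f n y ∈ B ∧ r (f n y) y} := by
  ext y
  simp only [mem_iUnion]
  constructor
  · rintro ⟨x, hx, hxy⟩
    obtain ⟨n, hn⟩ := (hfR y x).1 (hR.symm (hrR _ _ hxy))
    exact ⟨n, by rw [hn]; exact hx, by rw [hn]; exact hxy⟩
  · rintro ⟨n, h1, h2⟩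
    exact ⟨_, h1, h2⟩

theorem measurableSet_saturation (hR : IsCountableBorelEquivOn univ R)
    (hf : ∀ n, Measurable (f n)) (hfR : ∀ x y, R x y ↔ ∃ n, f n x = y) {B : Set X}
    (hB : MeasurableSet B) {D : Set X} {r : X → X → Prop}
    (hr : IsCountableBorelEquivOn D r) (hrR : ∀ x y, r x y → R x y) :
    MeasurableSet (saturation r B) := by
  rw [saturation_eq_iUnion_preimage hR hfR B hrR]
  exact MeasurableSet.iUnion fun n =>
    (hf n hB).inter (measurableSet_rel_comp hr (hf n) measurable_id)

/-- The points that are joined to `A` by a chain of at most `n` steps in the relations `R' i`. -/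
def level (A : Set X) (R' : I → X → X → Prop) : ℕ → Set X
  | 0 => A
  | n + 1 => level A R' n ∪ {x | ∃ i, ∃ y ∈ level A R' n, R' i x y}

theorem level_mono {X I : Type*} {R' : I → X → X → Prop} {A : Set X} : Monotone (level A R') :=
  monotone_nat_of_le_succ fun _ => subset_union_left

theorem exists_mem_level (hfree : IsFreeProduct univ R A' R')
    {x : X} (hx : x ∈ saturation R A) : ∃ n, x ∈ level A R' n := by
  obtain ⟨a, ha, hax⟩ := hx
  have hgen := ((hfree.generates a x).1 hax).2.2
  have key : ∀ x y, Relation.EqvGen (fun a b => ∃ j, R' j a b) x y →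
      ((∃ n, x ∈ level A R' n) ↔ ∃ n, y ∈ level A R' n) := by
    intro x y h
    induction h with
    | rel x y h =>
      obtain ⟨i, hi⟩ := h
      exact ⟨fun ⟨n, hn⟩ => ⟨n + 1, Or.inr ⟨i, x, hn, (hfree.factor i).symm hi⟩⟩,
        fun ⟨n, hn⟩ => ⟨n + 1, Or.inr ⟨i, y, hn, hi⟩⟩⟩
    | refl x => rfl
    | symm x y _ ih => exact ih.symm
    | trans x y z _ _ ih1 ih2 => exact ih1.trans ih2
  exact (key a x hgen).1 ⟨0, ha⟩

theorem measurableSet_level [Countable I] (hR : IsCountableBorelEquivOn univ R)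
    (hfree : IsFreeProduct univ R A' R') (hA : MeasurableSet A)
    (hf : ∀ n, Measurable (f n)) (hfR : ∀ x y, R x y ↔ ∃ n, f n x = y) (n : ℕ) :
    MeasurableSet (level A R' n) := by
  induction n with
  | zero => exact hA
  | succ n ih =>
    refine ih.union ?_
    have : {x | ∃ i, ∃ y ∈ level A R' n, R' i x y} = ⋃ i, saturation (R' i) (level A R' n) := by
      ext x
      simp only [mem_iUnion]
      exact ⟨fun ⟨i, y, hy, h⟩ => ⟨i, y, hy, (hfree.factor i).symm h⟩,
        fun ⟨i, y, hy, h⟩ => ⟨i, y, hy, (hfree.factor i).symm h⟩⟩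
    rw [this]
    exact MeasurableSet.iUnion fun i =>
      measurableSet_saturation hR hf hfR ih (hfree.factor i) (hfree.subrelation i)

/-- A Borel choice of parents closer to `A`, such that two successive parent steps are never taken
in the same factor. -/
theorem exists_parent [Countable I] (hR : IsCountableBorelEquivOn univ R)
    (hfree : IsFreeProduct univ R A' R') (hA : MeasurableSet A)
    (hf : ∀ n, Measurable (f n)) (hfR : ∀ x y, R x y ↔ ∃ n, f n x = y) :
    ∃ (p : X → X) (rank : X → ℕ), Measurable p ∧
      (∀ x ∈ saturation R A, x ∉ A → ∃ i, R' i x (p x)) ∧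
      (∀ x ∈ saturation R A, x ∉ A → rank (p x) < rank x) ∧
      ∀ i, ∀ x ∈ saturation R A, x ∉ A → R' i x (p x) → p x ∉ A → ¬ R' i (p x) (p (p x)) := by
  classical
  have hlev := fun n => measurableSet_level hR hfree hA hf hfR n
  obtain ⟨p, hpm, hp⟩ := exists_measurable_selection hf
    (p := fun m x => ∃ i, R' i x (f m x) ∧ ∃ n, f m x ∈ level A R' n ∧ x ∉ level A R' n)
    (fun m => by
      have : {x | ∃ i, R' i x (f m x) ∧ ∃ n, f m x ∈ level A R' n ∧ x ∉ level A R' n} =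
          (⋃ i, {x | R' i x (f m x)}) ∩ ⋃ n, (f m ⁻¹' level A R' n ∩ (level A R' n)ᶜ) := by
        ext x; simp
      rw [this]
      exact (MeasurableSet.iUnion fun i =>
        measurableSet_rel_comp (hfree.factor i) measurable_id (hf m)).inter
        (MeasurableSet.iUnion fun n => (hf m (hlev n)).inter (hlev n).compl))
  have hspec : ∀ x ∈ saturation R A, x ∉ A →
      ∃ i, R' i x (p x) ∧ ∃ n, p x ∈ level A R' n ∧ x ∉ level A R' n := by
    intro x hx hxA
    have hex := exists_mem_level hfree hx
    obtain ⟨m, hm, hmp⟩ := hp x (by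
      obtain ⟨n, hn⟩ : ∃ n, Nat.find hex = n + 1 := by
        refine ⟨Nat.find hex - 1, (Nat.succ_pred_eq_of_ne_zero fun h0 => hxA ?_).symm⟩
        have := Nat.find_spec hex
        rwa [h0] at this
      have hxn : x ∉ level A R' n := Nat.find_min hex (by omega)
      have hxs : x ∈ level A R' (n + 1) := hn ▸ Nat.find_spec hex
      obtain h | ⟨i, y, hy, hxy⟩ := hxs
      · exact absurd h hxn
      · obtain ⟨m, rfl⟩ := (hfR x y).1 (hfree.subrelation _ _ _ hxy)
        exact ⟨m, i, hxy, n, hy, hxn⟩)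
    rw [hm]
    exact hmp
  have hsat : ∀ x ∈ saturation R A, x ∉ A → p x ∈ saturation R A := fun x hx hxA => by
    obtain ⟨i, hi, -⟩ := hspec x hx hxA
    exact mem_saturation_of_rel hR hx (hfree.subrelation _ _ _ hi)
  refine ⟨p, fun x => sInf {n | x ∈ level A R' n}, hpm,
    fun x hx hxA => (hspec x hx hxA).imp fun i h => h.1, fun x hx hxA => ?_, ?_⟩
  · obtain ⟨i, -, n, hn, hxn⟩ := hspec x hx hxA
    refine lt_of_le_of_lt (Nat.sInf_le hn) ?_
    by_contra! hle
    have : x ∈ level A R' (sInf {n | x ∈ level A R' n}) :=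
      Nat.sInf_mem (exists_mem_level hfree hx)
    exact hxn (level_mono hle this)
  · intro i x hx hxA hi hpA hpi
    obtain ⟨-, -, n, hn, hxn⟩ := hspec x hx hxA
    obtain ⟨-, -, l, hl, hpl⟩ := hspec _ (hsat x hx hxA) hpA
    -- If both steps were in `R' i`, transitivity would place `x` one step from level `l`, hence in
    -- level `n`, which it avoids.
    have hln : l + 1 ≤ n := by
      by_contra! h
      exact hpl (level_mono (by omega) hn)
    exact hxn (level_mono hln (Or.inr ⟨i, _, hl, (hfree.factor i).trans hi hpi⟩))

/-- Iterating a Borel choice of parents gives a Borel projection onto `A`. -/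
theorem exists_projection (hA : MeasurableSet A) {S : Set X} {p : X → X} {rank : X → ℕ}
    (hp : Measurable p) (hpS : ∀ x ∈ S, x ∉ A → p x ∈ S)
    (hrank : ∀ x ∈ S, x ∉ A → rank (p x) < rank x) :
    ∃ π : X → X, Measurable π ∧ (∀ x ∈ A, π x = x) ∧
      ∀ x ∈ S, x ∉ A → π (p x) = π x := by
  classical
  -- Fixing `A` pointwise makes the orbit stationary once it reaches `A`, so its value there does
  -- not depend on the exponent selected.
  let g : X → X := fun x => if x ∈ A then x else p x
  have hg : Measurable g := Measurable.ite hA measurable_id hp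
  have hgA : ∀ n, ∀ x ∈ A, g^[n] x = x := by
    intro n x hx
    exact Function.iterate_fixed (by simp [g, hx]) n
  obtain ⟨π, hπm, hπ⟩ := exists_measurable_selection (f := fun n => g^[n])
    (fun n => hg.iterate n) (p := fun n x => g^[n] x ∈ A) (fun n => hg.iterate n hA)
  have huniq : ∀ m n x, g^[m] x ∈ A → g^[n] x ∈ A → g^[m] x = g^[n] x := by
    have key : ∀ m n x, m ≤ n → g^[m] x ∈ A → g^[m] x = g^[n] x := by
      intro m n x hmn h
      obtain ⟨k, rfl⟩ := Nat.exists_eq_add_of_le' hmn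
      rw [Function.iterate_add_apply, hgA k _ h]
    intro m n x hm hn
    rcases le_total m n with h | h
    exacts [key m n x h hm, (key n m x h hn).symm]
  have hex : ∀ x ∈ S, ∃ n, g^[n] x ∈ A := by
    intro x hx
    induction h : rank x using Nat.strong_induction_on generalizing x with
    | _ r ih =>
      by_cases hxA : x ∈ A
      · exact ⟨0, hxA⟩
      obtain ⟨n, hn⟩ := ih _ (h ▸ hrank x hx hxA) (p x) (hpS x hx hxA) rfl
      exact ⟨n + 1, by simpa [g, hxA] using hn⟩
  refine ⟨π, hπm, fun x hx => ?_, fun x hx hxA => ?_⟩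
  · obtain ⟨n, hn, -⟩ := hπ x ⟨0, hx⟩
    rw [hn]
    exact hgA n x hx
  · obtain ⟨m, hm, hmA⟩ := hπ x (hex x hx)
    obtain ⟨n, hn, hnA⟩ := hπ (p x) (hex _ (hpS x hx hxA))
    have h1 : g^[n + 1] x = g^[n] (p x) := by simp [g, hxA]
    rw [hm, hn, ← h1]
    exact huniq _ _ _ (h1 ▸ hnA) hmA

/-- There are retraction systems made of Borel sets and Borel maps, with Borel inverses `ψ k` of the
projection on the pieces, in which the pieces with index zero are the sets `A' i ∩ A`. -/
theorem exists_retractionSystem [StandardBorelSpace X] [Countable I]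
    (hR : IsCountableBorelEquivOn univ R)
    (hfree : IsFreeProduct univ R A' R') (hA : MeasurableSet A)
    (hf : ∀ n, Measurable (f n)) (hfR : ∀ x y, R x y ↔ ∃ n, f n x = y) :
    ∃ (P : RetractionSystem R A' R' A) (ψ : ℕ → X → X), Measurable P.proj ∧
      (∀ i, Measurable (P.retract i)) ∧ (∀ i k, MeasurableSet (P.piece i k)) ∧
      (∀ k, Measurable (ψ k)) ∧ (∀ i k, ∀ z ∈ P.piece i k, ψ k (P.proj z) = z) ∧ ψ 0 = id ∧
      ∀ i, P.piece i 0 = A' i ∩ A := by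
  classical
  obtain ⟨p, rank, hpm, hpR, hrank, hpp⟩ := exists_parent hR hfree hA hf hfR
  set S := saturation R A with hS
  have hSm : MeasurableSet S := measurableSet_saturation hR hf hfR hA hR fun _ _ h => h
  have hAS : A ⊆ S := subset_saturation hR
  have hrelS : ∀ i x y, x ∈ S → R' i x y → y ∈ S := fun i x y hx h =>
    mem_saturation_of_rel hR hx (hfree.subrelation _ _ _ h)
  have hpS : ∀ x ∈ S, x ∉ A → p x ∈ S := fun x hx hxA => by
    obtain ⟨i, hi⟩ := hpR x hx hxA
    exact hrelS i x _ hx hi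
  obtain ⟨π, hπm, hπA, hπp⟩ := exists_projection hA hpm hpS hrank
  have hπ : ∀ x ∈ S, π x ∈ A ∧ R x (π x) := by
    intro x hx
    induction h : rank x using Nat.strong_induction_on generalizing x with
    | _ r ih =>
      by_cases hxA : x ∈ A
      · rw [hπA x hxA]
        exact ⟨hxA, hR.refl trivial⟩
      obtain ⟨h1, h2⟩ := ih _ (h ▸ hrank x hx hxA) (p x) (hpS x hx hxA) rfl
      obtain ⟨i, hi⟩ := hpR x hx hxA
      rw [← hπp x hx hxA]
      exact ⟨h1, hR.trans (hfree.subrelation _ _ _ hi) h2⟩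
  let ψ : ℕ → X → X := fun k => Nat.casesOn k id f
  have hψm : ∀ k, Measurable (ψ k) := by
    rintro (_ | k)
    exacts [measurable_id, hf k]
  -- These are the points at which the path of parents does not continue inside the `R' i`-class.
  -- Since consecutive parent steps never share a factor, one step suffices to reach such a point.
  let exit : I → Set X := fun i => (A' i ∩ S) ∩ (A ∪ {x | R' i x (p x)}ᶜ)
  have hA'm : ∀ i, MeasurableSet (A' i) := fun i => (hfree.factor i).measurableSet_domain
  have hpim : ∀ i, MeasurableSet {x | R' i x (p x)} := fun i =>
    measurableSet_rel_comp (hfree.factor i) measurable_id hpm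
  have hexm : ∀ i, MeasurableSet (exit i) := fun i =>
    ((hA'm i).inter hSm).inter (hA.union (hpim i).compl)
  have hpexit : ∀ i, ∀ x ∈ S, x ∉ A → R' i x (p x) → p x ∈ exit i := by
    intro i x hx hxA hi
    refine ⟨⟨((hfree.factor i).mem_domain hi).2, hpS x hx hxA⟩, ?_⟩
    by_cases hpA : p x ∈ A
    · exact Or.inl hpA
    · exact Or.inr (hpp i x hx hxA hi hpA)
  -- On `W i k` the map `ψ k` inverts `π`. As `ψ 0 = id`, index zero selects the points of `A`; the
  -- shifted enumeration `f` covers all other exit points.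
  let W : I → ℕ → Set X := fun i k => exit i ∩ {x | ψ k (π x) = x}
  have hWm : ∀ i k, MeasurableSet (W i k) := fun i k =>
    (hexm i).inter (measurableSet_eq_fun ((hψm k).comp hπm) measurable_id)
  -- Each class keeps only its least index, so it meets exactly one piece.
  let Z : I → ℕ → Set X := fun i k => W i k ∩ ⋂ l ∈ {l | l < k}, (saturation (R' i) (W i l))ᶜ
  have hZm : ∀ i k, MeasurableSet (Z i k) := fun i k =>
    (hWm i k).inter (MeasurableSet.biInter (to_countable _) fun l _ =>
      (measurableSet_saturation hR hf hfR (hWm i l) (hfree.factor i)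
        (hfree.subrelation i)).compl)
  have hZ : ∀ i, ∀ x ∈ A' i ∩ S, ∃ m k, f m x ∈ Z i k ∧ R' i x (f m x) := by
    intro i x hx
    obtain ⟨y, hy, hxy⟩ : ∃ y ∈ exit i, R' i x y := by
      by_cases hxe : x ∈ exit i
      · exact ⟨x, hxe, (hfree.factor i).refl hx.1⟩
      · have h1 : x ∉ A := fun h => hxe ⟨hx, Or.inl h⟩
        have h2 : R' i x (p x) := by
          by_contra h
          exact hxe ⟨hx, Or.inr h⟩
        exact ⟨p x, hpexit i x hx.2 h1 h2, h2⟩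
    have hex : {k : ℕ | ∃ y ∈ W i k, R' i x y}.Nonempty := by
      obtain ⟨m, hm⟩ := (hfR _ _).1 (hR.symm (hπ y hy.1.2).2)
      exact ⟨m + 1, y, ⟨hy, hm⟩, hxy⟩
    obtain ⟨z, hz, hxz⟩ := Nat.sInf_mem hex
    obtain ⟨m, rfl⟩ := (hfR _ _).1 (hfree.subrelation _ _ _ hxz)
    refine ⟨m, _, ⟨hz, mem_iInter₂.2 fun l hl => ?_⟩, hxz⟩
    rintro ⟨u, hu, huz⟩
    exact Nat.notMem_of_lt_sInf hl
      ⟨u, hu, (hfree.factor i).trans hxz ((hfree.factor i).symm huz)⟩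
  have hq : ∀ i, ∃ q : X → X, Measurable q ∧
      ∀ x ∈ A' i ∩ S, R' i x (q x) ∧ ∃ k, q x ∈ Z i k := by
    intro i
    obtain ⟨q, hqm, hq⟩ := exists_measurable_selection hf
      (p := fun m x => x ∈ (⋃ k, f m ⁻¹' Z i k) ∩ {x | R' i x (f m x)}) (fun m =>
        (MeasurableSet.iUnion fun k => hf m (hZm i k)).inter
          (measurableSet_rel_comp (hfree.factor i) measurable_id (hf m)))
    refine ⟨q, hqm, fun x hx => ?_⟩
    obtain ⟨m, hm, h1, h2⟩ := hq x (by
      obtain ⟨m, k, h1, h2⟩ := hZ i x hx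
      exact ⟨m, mem_iUnion.2 ⟨k, h1⟩, h2⟩)
    rw [hm]
    obtain ⟨k, hk⟩ := mem_iUnion.1 h1
    exact ⟨h2, k, hk⟩
  choose q hqm hq using hq
  let q' : I → X → X := fun i x => if x ∈ ⋃ k, Z i k then x else q i x
  have hq'm : ∀ i, Measurable (q' i) := fun i =>
    Measurable.ite (MeasurableSet.iUnion fun k => hZm i k) measurable_id (hqm i)
  have hq' : ∀ i, ∀ x ∈ A' i ∩ S, R' i x (q' i x) ∧ ∃ k, q' i x ∈ Z i k := by
    intro i x hx
    by_cases h : x ∈ ⋃ k, Z i k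
    · simp only [q', if_pos h]
      exact ⟨(hfree.factor i).refl hx.1, mem_iUnion.1 h⟩
    · simp only [q', if_neg h]
      exact hq i x hx
  -- Passing to the exit point before applying `q'` makes a point and its parent in the same class
  -- have equal retractions.
  let r : I → X → X := fun i x => if x ∈ A ∪ {x | R' i x (p x)}ᶜ then q' i x else q' i (p x)
  have hrm : ∀ i, Measurable (r i) := fun i =>
    Measurable.ite (hA.union (hpim i).compl) (hq'm i) ((hq'm i).comp hpm)
  have hr : ∀ i, ∀ x ∈ A' i ∩ S, R' i x (r i x) ∧ ∃ k, r i x ∈ Z i k := by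
    intro i x hx
    by_cases h : x ∈ A ∪ {x | R' i x (p x)}ᶜ
    · simp only [r, if_pos h]
      exact hq' i x hx
    · simp only [r, if_neg h]
      have h1 : x ∉ A := fun h' => h (Or.inl h')
      have h2 : R' i x (p x) := by
        by_contra h'
        exact h (Or.inr h')
      obtain ⟨h3, h4⟩ := hq' i (p x) (hpexit i x hx.2 h1 h2).1
      exact ⟨(hfree.factor i).trans h2 h3, h4⟩
  refine ⟨{
    parent := p
    rank := rank
    proj := π
    piece := Z
    retract := r
    exists_rel_parent := hpR
    rank_parent_lt := hrank
    proj_of_mem := hπA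
    proj_parent := hπp
    piece_subset := fun i k x hx => hx.1.1.1
    index_unique := ?_
    injOn_proj := ?_
    rel_retract := fun i x hx => (hr i x hx).1
    retract_mem := fun i x hx => (hr i x hx).2
    retract_of_mem := ?_
    retract_parent := ?_ }, ψ, hπm, hrm, hZm, hψm, fun i k z hz => hz.1.2, rfl, ?_⟩
  · have key : ∀ i k l x y, x ∈ Z i k → y ∈ Z i l → R' i x y → ¬ k < l :=
      fun i k l x y hx hy hxy hkl => mem_iInter₂.1 hy.2 k hkl ⟨x, hx.1, hxy⟩
    intro i k l x hx y hy hxy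
    exact le_antisymm (not_lt.1 (key i l k y x hy hx ((hfree.factor i).symm hxy)))
      (not_lt.1 (key i k l x y hx hy hxy))
  · intro i k x hx y hy hxy
    rw [← hx.1.2, ← hy.1.2, hxy]
  · intro i k x hx
    have h1 : x ∈ A ∪ {x | R' i x (p x)}ᶜ := hx.1.1.2
    have h2 : x ∈ ⋃ k, Z i k := mem_iUnion.2 ⟨k, hx⟩
    simp only [r, q', if_pos h1, if_pos h2]
  · intro i x hx hxA hi
    have h1 : p x ∈ A ∪ {x | R' i x (p x)}ᶜ := (hpexit i x hx hxA hi).2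
    have h2 : x ∉ A ∪ {x | R' i x (p x)}ᶜ := by
      rintro (h | h)
      exacts [hxA h, h hi]
    simp only [r, if_pos h1, if_neg h2]
  · intro i
    ext x
    constructor
    · intro hx
      refine ⟨hx.1.1.1.1, ?_⟩
      have h1 : π x = x := hx.1.2
      rw [← h1]
      exact (hπ x hx.1.1.1.2).1
    · rintro ⟨hx, hxA⟩
      exact ⟨⟨⟨⟨hx, hAS hxA⟩, Or.inl hxA⟩, hπA x hxA⟩,
        mem_iInter₂.2 fun l hl => absurd hl (Nat.not_lt_zero l)⟩

end BorelConstruction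

end BER

open Set

namespace BER

/-! ### Partial isomorphisms, treeability and the partition into saturations -/

section Kurosh

variable {X I : Type*} {R : X → X → Prop}
  {A' : I → Set X} {R' : I → X → X → Prop} {A : Set X} {f : ℕ → X → X}

namespace RetractionSystem

variable (P : RetractionSystem R A' R' A)

/-- The partial inverse of `proj` on `piece i k`. -/
def lift (ψ : ℕ → X → X) (hψ : ∀ i k, ∀ z ∈ P.piece i k, ψ k (P.proj z) = z) (i : I) (k : ℕ) :
    PartialEquiv X X where
  toFun := ψ k
  invFun := P.proj
  -- This is the image of the piece under `proj`, in a form that is visibly Borel.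
  source := {a | ψ k a ∈ P.piece i k ∧ P.proj (ψ k a) = a}
  target := P.piece i k
  map_source' _ ha := ha.1
  map_target' z hz := by
    change ψ k (P.proj z) ∈ P.piece i k ∧ P.proj (ψ k (P.proj z)) = P.proj z
    rw [hψ i k z hz]
    exact ⟨hz, rfl⟩
  left_inv' _ ha := ha.2
  right_inv' z hz := hψ i k z hz

theorem conj_lift_iff {ψ : ℕ → X → X} (hψ : ∀ i k, ∀ z ∈ P.piece i k, ψ k (P.proj z) = z) (i : I)
    (k : ℕ) (a b : X) :
    conj (P.lift ψ hψ i k) (restr (R' i) (P.lift ψ hψ i k).target) a b ↔ P.factor i k a b := by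
  constructor
  · rintro ⟨ha, hb, ha', hb', h⟩
    exact ⟨_, ha', _, hb', ha.2, hb.2, h⟩
  · rintro ⟨z, hz, z', hz', rfl, rfl, h⟩
    refine ⟨(P.lift ψ hψ i k).map_target hz, (P.lift ψ hψ i k).map_target hz', ?_⟩
    have h1 : P.lift ψ hψ i k (P.proj z) = z := hψ i k z hz
    have h2 : P.lift ψ hψ i k (P.proj z') = z' := hψ i k z' hz'
    rw [h1, h2]
    exact ⟨hz, hz', h⟩

end RetractionSystem

variable [MeasurableSpace X]

/-- Reachability in a Borel graph is Borel if the graph is contained in a countable Borel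
equivalence relation. -/
theorem measurableSet_reachable [StandardBorelSpace X] (hf : ∀ n, Measurable (f n))
    (hfR : ∀ x y, R x y ↔ ∃ n, f n x = y) {H : SimpleGraph X}
    (hH : MeasurableSet {p : X × X | H.Adj p.1 p.2}) (hHR : ∀ x y, H.Adj x y → R x y) :
    MeasurableSet {p : X × X | H.Reachable p.1 p.2} := by
  -- `Q n` consists of the pairs joined by a walk of length `n`; the next vertex is some `f m` of
  -- the current one, so only countable unions occur.
  let Q : ℕ → Set (X × X) := fun n => Nat.rec {p | p.1 = p.2}
    (fun _ Q => ⋃ m, ({p | H.Adj p.1 (f m p.1)} ∩ {p | (f m p.1, p.2) ∈ Q})) n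
  have hQm : ∀ n, MeasurableSet (Q n) := by
    intro n
    induction n with
    | zero => exact measurableSet_eq_fun measurable_fst measurable_snd
    | succ n ih =>
      refine MeasurableSet.iUnion fun m => ?_
      have hm : Measurable fun p : X × X => f m p.1 := (hf m).comp measurable_fst
      exact ((measurable_fst.prodMk hm) hH).inter ((hm.prodMk measurable_snd) ih)
  have : {p : X × X | H.Reachable p.1 p.2} = ⋃ n, Q n := by
    ext ⟨x, y⟩
    rw [mem_iUnion]
    constructor
    · intro h
      obtain ⟨w⟩ : H.Reachable x y := h
      induction w with
      | nil => exact ⟨0, rfl⟩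
      | cons hadj _ ih =>
        obtain ⟨n, hn⟩ := ih
        obtain ⟨m, rfl⟩ := (hfR _ _).1 (hHR _ _ hadj)
        exact ⟨n + 1, mem_iUnion.2 ⟨m, hadj, hn⟩⟩
    · rintro ⟨n, hn⟩
      induction n generalizing x with
      | zero =>
        obtain rfl : x = y := hn
        exact SimpleGraph.Reachable.refl x
      | succ n ih =>
        obtain ⟨m, h1, h2⟩ := mem_iUnion.1 hn
        have h1' : H.Adj x (f m x) := h1
        exact h1'.reachable.trans (ih _ h2)
  rw [this]
  exact MeasurableSet.iUnion hQm

/-- The restriction of a countable Borel equivalence relation to a Borel set, pulled back by a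
partial Borel isomorphism. -/
theorem isCountableBorelEquivOn_conj {φ : PartialEquiv X X} (hφ : Measurable φ)
    (hs : MeasurableSet φ.source) {D : Set X} {r : X → X → Prop}
    (hr : IsCountableBorelEquivOn D r) (hD : φ.target ⊆ D) :
    IsCountableBorelEquivOn φ.source (conj φ (restr r φ.target)) := by
  have hiff : ∀ x y, conj φ (restr r φ.target) x y ↔
      x ∈ φ.source ∧ y ∈ φ.source ∧ r (φ x) (φ y) := fun x y =>
    ⟨fun ⟨hx, hy, h⟩ => ⟨hx, hy, h.2.2⟩,
      fun ⟨hx, hy, h⟩ => ⟨hx, hy, φ.map_source hx, φ.map_source hy, h⟩⟩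
  refine ⟨hs, ?_, fun x y h => ⟨h.1, h.2.1⟩, fun x hx => ?_, fun x y h => ?_, fun x y z h h' => ?_,
    fun x => ?_⟩
  · simp only [hiff]
    exact (measurable_fst hs).inter ((measurable_snd hs).inter (measurableSet_rel_comp hr
      (hφ.comp measurable_fst) (hφ.comp measurable_snd)))
  · exact (hiff x x).2 ⟨hx, hx, hr.refl (hD (φ.map_source hx))⟩
  · rw [hiff] at h ⊢
    exact ⟨h.2.1, h.1, hr.symm h.2.2⟩
  · rw [hiff] at h h' ⊢
    exact ⟨h.1, h'.2.1, hr.trans h.2.2 h'.2.2⟩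
  · simp only [hiff]
    exact MapsTo.countable_of_injOn (f := φ) (fun y hy => hy.2.2)
      (φ.injOn.mono fun y hy => hy.2.1) (hr.countable_class (φ x))

namespace RetractionSystem

variable (P : RetractionSystem R A' R' A)

theorem isTreeable_tree [StandardBorelSpace X] [Countable I]
    (hR : IsCountableBorelEquivOn univ R) (hfree : IsFreeProduct univ R A' R')
    (hA : MeasurableSet A) (hf : ∀ n, Measurable (f n)) (hfR : ∀ x y, R x y ↔ ∃ n, f n x = y)
    (hproj : Measurable P.proj) (hret : ∀ i, Measurable (P.retract i)) :
    IsTreeable A P.tree := by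
  have hSm : MeasurableSet (saturation R A) :=
    measurableSet_saturation hR hf hfR hA hR fun _ _ h => h
  have hedge : MeasurableSet {p : X × X | P.edge p.1 p.2} := by
    have : {p : X × X | P.edge p.1 p.2} = ⋃ (i : I) (m : ℕ), {p : X × X |
        f m p.1 ∈ A' i ∩ saturation R A ∧ P.proj (f m p.1) = p.1 ∧
          P.proj (P.retract i (f m p.1)) = p.2} := by
      ext ⟨a, b⟩
      simp only [mem_iUnion]
      constructor
      · rintro ⟨i, x, hx, rfl, rfl⟩
        obtain ⟨m, hm⟩ := (hfR _ _).1 (hR.symm (P.proj_mem_and_rel hR hfree x hx.2).2)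
        refine ⟨i, m, ?_⟩
        change f m (P.proj x) ∈ _ ∧ P.proj (f m (P.proj x)) = P.proj x ∧
          P.proj (P.retract i (f m (P.proj x))) = P.proj (P.retract i x)
        rw [hm]
        exact ⟨hx, rfl, rfl⟩
      · rintro ⟨i, m, h1, h2, h3⟩
        exact ⟨i, f m a, h1, h2, h3⟩
    rw [this]
    refine MeasurableSet.iUnion fun i => MeasurableSet.iUnion fun m => ?_
    have hm : Measurable fun p : X × X => f m p.1 := (hf m).comp measurable_fst
    exact (hm ((hfree.factor i).measurableSet_domain.inter hSm)).inter
      ((measurableSet_eq_fun (hproj.comp hm) measurable_fst).inter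
        (measurableSet_eq_fun (hproj.comp ((hret i).comp hm)) measurable_snd))
  have hadj : MeasurableSet {p : X × X | P.graph.Adj p.1 p.2} := by
    simp only [graph, SimpleGraph.fromRel_adj]
    exact (measurableSet_eq_fun measurable_fst measurable_snd).compl.inter
      (hedge.union (measurable_swap hedge))
  have hadjR : ∀ x y, P.graph.Adj x y → R x y := fun x y h =>
    (P.mem_and_rel_of_adj hR hfree h).2.2
  refine ⟨⟨hA, ?_, fun x y h => ⟨h.1, h.2.1⟩, fun x hx => ⟨hx, hx, .refl x⟩,
    fun x y h => ⟨h.2.1, h.1, h.2.2.symm⟩, fun x y z h h' => ⟨h.1, h'.2.1, h.2.2.trans h'.2.2⟩,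
    fun x => ?_⟩, P.graph, hadj, P.isAcyclic_graph hR hfree, fun x y h => ?_, fun x y => Iff.rfl⟩
  · exact (measurable_fst hA).inter ((measurable_snd hA).inter
      (measurableSet_reachable hf hfR hadj hadjR))
  · exact (hR.countable_class x).mono fun y hy => rel_of_reachable hR hadjR hy.2.2
  · exact ⟨(P.mem_and_rel_of_adj hR hfree h).1, (P.mem_and_rel_of_adj hR hfree h).2.1⟩

theorem iUnion_saturation_piece (hR : IsCountableBorelEquivOn univ R)
    (hfree : IsFreeProduct univ R A' R') (i : I) :
    ⋃ k : {k // (P.piece i k).Nonempty}, saturation (R' i) (P.piece i k) =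
      A' i ∩ saturation R A := by
  ext x
  rw [mem_iUnion]
  constructor
  · rintro ⟨k, z, hz, hzx⟩
    exact ⟨((hfree.factor i).mem_domain hzx).2, mem_saturation_of_rel hR (P.piece_subset i k hz).2
      (hfree.subrelation _ _ _ hzx)⟩
  · intro hx
    obtain ⟨k, hk⟩ := P.retract_mem i x hx
    exact ⟨⟨k, _, hk⟩, _, hk, (hfree.factor i).symm (P.rel_retract i x hx)⟩

theorem disjoint_saturation_piece (hfree : IsFreeProduct univ R A' R') (i : I) {k l : ℕ}
    (hkl : k ≠ l) : Disjoint (saturation (R' i) (P.piece i k)) (saturation (R' i) (P.piece i l)) := by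
  rw [Set.disjoint_left]
  rintro x ⟨z, hz, hzx⟩ ⟨z', hz', hzx'⟩
  exact hkl (P.index_unique i k l z hz z' hz'
    ((hfree.factor i).trans hzx ((hfree.factor i).symm hzx')))

end RetractionSystem

end Kurosh

end BER

/-! ### The subrelation theorem -/

theorem mainTheorem2 {X : Type*} [MeasurableSpace X] [StandardBorelSpace X]
    {I : Type*} [Countable I]
    (R : X → X → Prop) (hR : BER.IsCountableBorelEquivOn Set.univ R)
    (A' : I → Set X) (R' : I → X → X → Prop)
    (hcover : ⋃ i, A' i = Set.univ)
    (hfree : BER.IsFreeProduct Set.univ R A' R')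
    (A : Set X) (hA : MeasurableSet A) :
    ∃ (K : I → Type) (φ : (i : I) → K i → PartialEquiv X X)
      (D : Set X) (T : X → X → Prop),
      (∀ i, Countable (K i)) ∧
      (∀ i k, BER.MemFullPseudogroup R (φ i k) ∧ (φ i k).source.Nonempty ∧
        (φ i k).source ⊆ A ∧ (φ i k).target ⊆ A' i) ∧
      BER.IsTreeable D T ∧
      -- the restriction of `R` to `A` is the free product of `T` and of all the conjugates
      BER.IsFreeProduct A (BER.restr R A)
        (fun j : Option (Σ i, K i) => j.elim D (fun p => (φ p.1 p.2).source))
        (fun j : Option (Σ i, K i) => j.elim T (fun p =>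
          BER.conj (φ p.1 p.2) (BER.restr (R' p.1) (φ p.1 p.2).target))) ∧
      -- the saturations of the targets form a Borel partition
      (∀ i, (∀ k, MeasurableSet (BER.saturation (R' i) (φ i k).target)) ∧
        Pairwise (fun k l => Disjoint (BER.saturation (R' i) (φ i k).target)
          (BER.saturation (R' i) (φ i l).target)) ∧
        ⋃ k, BER.saturation (R' i) (φ i k).target = A' i ∩ BER.saturation R A) ∧
      -- one of the conjugates is the restriction of the factor to `A' i ∩ A`
      (∀ i, (A' i ∩ A).Nonempty → ∃ k, (φ i k).source = A' i ∩ A ∧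
        BER.conj (φ i k) (BER.restr (R' i) (φ i k).target) =
          BER.restr (R' i) (A' i ∩ A)) := by
  obtain ⟨f, hf, hfR⟩ := hR.exists_enum
  obtain ⟨P, ψ, hproj, hret, hpiece, hψm, hψ, hψ0, hP0⟩ :=
    BER.exists_retractionSystem hR hfree hA hf hfR
  have hsource : ∀ i k, ∀ a ∈ (P.lift ψ hψ i k).source, a ∈ A ∧ R a (ψ k a) := by
    intro i k a ha
    have h := P.proj_mem_and_rel hR hfree _ (P.piece_subset i k ha.1).2
    rw [ha.2] at h
    exact ⟨h.1, hR.symm h.2⟩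
  have hsm : ∀ i k, MeasurableSet (P.lift ψ hψ i k).source := fun i k =>
    (hψm k (hpiece i k)).inter (measurableSet_eq_fun (hproj.comp (hψm k)) measurable_id)
  have htarget : ∀ i k, (P.lift ψ hψ i k).target ⊆ A' i := fun i k z hz =>
    (P.piece_subset i k hz).1
  have htree := P.isTreeable_tree hR hfree hA hf hfR hproj hret
  -- Only nonempty pieces are kept as indices, and the tree relation lives on all of `A`, with
  -- trivial classes at isolated vertices.
  refine ⟨fun i => {k : ℕ // (P.piece i k).Nonempty}, fun i k => P.lift ψ hψ i k, A, P.tree,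
    fun i => inferInstance, fun i k => ⟨⟨hsm i k, hpiece i k, ?_, ?_, ?_⟩, ?_, ?_, htarget i k⟩,
    htree, ?_, fun i => ⟨fun k => ?_, ?_, ?_⟩, ?_⟩
  · exact (hψm k).comp measurable_subtype_coe
  · exact hproj.comp measurable_subtype_coe
  · exact fun a ha => (hsource i k a ha).2
  · obtain ⟨z, hz⟩ := k.2
    exact ⟨_, (P.lift ψ hψ i k).map_target hz⟩
  · exact fun a ha => (hsource i k a ha).1
  · refine P.isFreeProduct (K := fun i => {k : ℕ // (P.piece i k).Nonempty}) hR hfree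
      (fun _ k => k.1) (fun i => Subtype.val_injective)
      (fun i k hk => ⟨⟨k, hk⟩, rfl⟩) ?_ (fun a b => Iff.rfl)
      (fun i k a b => P.conj_lift_iff hψ i k a b)
    rintro (_ | ⟨i, k⟩)
    · exact htree.isCountableBorelEquivOn
    · exact BER.isCountableBorelEquivOn_conj (hψm k) (hsm i k) (hfree.factor i) (htarget i k)
  · exact BER.measurableSet_saturation hR hf hfR (hpiece i k) (hfree.factor i)
      (hfree.subrelation i)
  · exact fun k l hkl => P.disjoint_saturation_piece hfree i fun h => hkl (Subtype.ext h)
  · exact P.iUnion_saturation_piece hR hfree i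
  · intro i hne
    have hsrc : (P.lift ψ hψ i 0).source = A' i ∩ A := by
      ext a
      change ψ 0 a ∈ P.piece i 0 ∧ P.proj (ψ 0 a) = a ↔ _
      rw [hψ0, hP0]
      exact ⟨fun h => h.1, fun h => ⟨h, P.proj_of_mem a h.2⟩⟩
    refine ⟨⟨0, (hP0 i).symm ▸ hne⟩, hsrc, ?_⟩
    have htgt : (P.lift ψ hψ i 0).target = A' i ∩ A := hP0 i
    have hfun : ∀ a, P.lift ψ hψ i 0 a = a := fun a => congrFun hψ0 a
    funext a b
    simp only [BER.conj, BER.restr, hsrc, htgt, hfun]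
    exact propext ⟨fun h => h.2.2, fun h => ⟨h.1, h.2.1, h⟩⟩
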